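/- Let $\Omega$ be a finite set and let $P=(P_{ij})_{i,j\in\Omega}$ be an irreducible stochastic matrix (nonnegative entries, all row sums equal to $1$, and for all $i,j$ some power of $P$ has a positive $(i,j)$ entry). For $n\ge 0$ let $Arv(P)_n$ be the space of complex $\Omega\times\Omega$ matrices $A$ with $A_{ij}=0$ whenever $(P^n)_{ij}=0$; it is a C*-correspondence over $C(\Omega)=\mathbb{C}^\Omega$ with left and right multiplication by diagonal matrices as actions and with inner product $\langle A,B\rangle=\mathrm{Diag}(A^*B)$. For $A\in Arv(P)_n$, $B\in Arv(P)_m$ let $$U_{n,m}(A\otimes B)=\bigl(\sqrt{P^{n+m}}\bigr)^{\flat}*\bigl[(\sqrt{P^n}*A)\cdot(\sqrt{P^m}*B)\bigr]\in Arv(P)_{n+m},$$ where $*$ is the entrywise product, the square root is taken entrywise, and $M^\flat$ has entry $M_{ij}^{-1}$ where $M_{ij}>0$ and $0$ elsewhere. Let $\mathcal{F}=\bigoplus_{n\ge 0}Arv(P)_n$ be the Hilbert C*-module direct sum over $C(\Omega)$, let $Q_n$ be the projection of $\mathcal F$ onto $Arv(P)_n$, and for $A\in Arv(P)_n$ let $S^{(n)}_A$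 be the adjointable operator on $\mathcal F$ with $S^{(n)}_A(B)=U_{n,m}(A\otimes B)$ for $B\in Arv(P)_m$. Let $\mathcal{T}_+(P)$ and $\mathcal{T}(P)$ be, respectively, the norm-closed subalgebra and the C*-subalgebra of the C*-algebra $\mathcal{L}(\mathcal F)$ of adjointable operators that are generated by $C(\Omega)$ (acting from the left) and all $S^{(n)}_A$, and let $\mathcal{J}(P)=\{T\in\mathcal{T}(P):\lim_{n\to\infty}\|TQ_n\|=0\}$ be the Cuntz–Pimsner ideal. Let $\rho:\mathcal{T}(P)\to B(H)$ be a unital $*$-representation on a Hilbert space $H$ with $\rho(\mathcal{J}(P))=\{0\}$. Then the unital completely contractive map $\varphi=\rho|_{\mathcal{T}_+(P)}$ 1. is maximal: whenever $K$ is a Hilbert space, $V:H\to K$ is an isometry and $\varphi':\mathcal{T}_+(P)\to B(K)$ is a unital completely contractive linear map with $\varphi(a)=V^*\varphi'(a)V$ for all $a$, then $\varphi'=\varphi\oplus\psi$ with respect to $K=VH\oplus(VH)^\perp$ for some unital completely contractive map $\psi$; and 2. has the unique extension property: $\varphi$ has exactly one extension to a unital completely positive map $\mathcal{T}(P)\to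 B(H)$, and this extension is a $*$-representation (namely $\rho$). -/

import Mathlib

section Adjointable

variable (A E : Type*) [CStarAlgebra A] [PartialOrder A]
  [NormedAddCommGroup E] [NormedSpace ℂ E] [SMul A E] [CStarModule A E]

/-- The adjointable operators on a Hilbert C*-module `E` over `A`, as an algebra of bounded
operators on `E`. -/
def adjointableSubalgebra : Subalgebra ℂ (E →L[ℂ] E) where
  carrier := {T | ∃ S : E →L[ℂ] E, ∀ x y, inner A (T x) y = inner A x (S y)}
  mul_mem' := by
    rintro T T' ⟨S, hS⟩ ⟨S', hS'⟩
    exact ⟨S' * S, fun x y => by simp [hS, hS']⟩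
  add_mem' := by
    rintro T T' ⟨S, hS⟩ ⟨S', hS'⟩
    exact ⟨S + S', fun x y => by simp [hS, hS']⟩
  algebraMap_mem' := fun c => ⟨algebraMap ℂ _ (star c), fun x y => by
    simp [Algebra.algebraMap_eq_smul_one]⟩

/-- The C*-algebra of adjointable operators on a Hilbert C*-module `E` over `A`, with the operator
norm. -/
def Adjointable : Type _ := ↥(adjointableSubalgebra A E)

namespace Adjointable

noncomputable instance : NormedRing (Adjointable A E) :=
  inferInstanceAs (NormedRing ↥(adjointableSubalgebra A E))

noncomputable instance : NormedAlgebra ℂ (Adjointable A E) :=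
  inferInstanceAs (NormedAlgebra ℂ ↥(adjointableSubalgebra A E))

/-- The inclusion of the adjointable operators into the bounded operators. -/
noncomputable def toCLM : Adjointable A E →ₐ[ℂ] (E →L[ℂ] E) := (adjointableSubalgebra A E).val

noncomputable instance : FunLike (Adjointable A E) E E where
  coe T := toCLM A E T
  coe_injective _ _ h := Subtype.ext (DFunLike.coe_injective h)

variable {A E}

lemma coe_toCLM (T : Adjointable A E) : ⇑(toCLM A E T) = T := rfl

@[simp] lemma mul_apply (T S : Adjointable A E) (x : E) : (T * S) x = T (S x) := rfl
@[simp] lemma one_apply (x : E) : (1 : Adjointable A E) x = x := rfl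
@[simp] lemma add_apply (T S : Adjointable A E) (x : E) : (T + S) x = T x + S x := rfl
@[simp] lemma sub_apply (T S : Adjointable A E) (x : E) : (T - S) x = T x - S x := rfl
@[simp] lemma zero_apply (x : E) : (0 : Adjointable A E) x = 0 := rfl
@[simp] lemma smul_apply (c : ℂ) (T : Adjointable A E) (x : E) : (c • T) x = c • T x := rfl

lemma norm_toCLM (T : Adjointable A E) : ‖toCLM A E T‖ = ‖T‖ := rfl

lemma le_norm (T : Adjointable A E) (x : E) : ‖T x‖ ≤ ‖T‖ * ‖x‖ := (toCLM A E T).le_opNorm x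

lemma ext_inner {x y : E} (h : ∀ z, inner A z x = inner A z y) : x = y := by
  rw [← sub_eq_zero, ← CStarModule.inner_self (A := A), CStarModule.inner_sub_right, h, sub_self]

noncomputable instance : Star (Adjointable A E) where
  star T := ⟨Classical.choose T.2, T.1, fun x y => by
    rw [← CStarModule.star_inner, ← Classical.choose_spec T.2, CStarModule.star_inner]⟩

/-- The defining property of the adjoint. -/
lemma star_inner_right (T : Adjointable A E) (x y : E) :
    inner A x (star T y) = inner A (T x) y := (Classical.choose_spec T.2 x y).symm

lemma star_inner_left (T : Adjointable A E) (x y : E) :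
    inner A (star T x) y = inner A x (T y) := by
  rw [← CStarModule.star_inner, star_inner_right, CStarModule.star_inner]

lemma eq_star_of {T S : Adjointable A E} (h : ∀ x y, inner A (T x) y = inner A x (S y)) :
    star T = S :=
  DFunLike.ext _ _ fun y => ext_inner (A := A) fun z => by rw [star_inner_right, h]

noncomputable instance : StarRing (Adjointable A E) where
  star_involutive T := eq_star_of fun x y => star_inner_left T x y
  star_mul T S := eq_star_of fun x y => by simp [star_inner_right]
  star_add T S := eq_star_of fun x y => by simp [star_inner_right]

instance : StarModule ℂ (Adjointable A E) where
  star_smul c T := eq_star_of fun x y => by simp [star_inner_right]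

variable [StarOrderedRing A]

lemma norm_mul_self_le_star (T : Adjointable A E) : ‖T‖ * ‖T‖ ≤ ‖star T * T‖ := by
  have key : ‖T‖ ≤ √‖star T * T‖ := by
    refine (toCLM A E T).opNorm_le_bound (Real.sqrt_nonneg _) fun x => ?_
    refine (sq_le_sq₀ (norm_nonneg _) (by positivity)).1 ?_
    rw [mul_pow, Real.sq_sqrt (norm_nonneg _), CStarModule.norm_sq_eq A, coe_toCLM,
      ← star_inner_right]
    calc _ ≤ ‖x‖ * ‖(star T * T) x‖ := CStarModule.norm_inner_le E
      _ ≤ ‖x‖ * (‖star T * T‖ * ‖x‖) := by gcongr; exact le_norm _ _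
      _ = ‖star T * T‖ * ‖x‖ ^ 2 := by ring
  calc ‖T‖ * ‖T‖ ≤ √‖star T * T‖ * √‖star T * T‖ := by gcongr
    _ = _ := Real.mul_self_sqrt (norm_nonneg _)

instance : CStarRing (Adjointable A E) := ⟨fun {T} => norm_mul_self_le_star T⟩

variable [CompleteSpace E]

instance : CompleteSpace (Adjointable A E) := by
  refine Metric.complete_of_cauchySeq_tendsto fun v hv => ?_
  have hiso : Isometry (toCLM A E) := AddMonoidHomClass.isometry_of_norm _ norm_toCLM
  have hw : CauchySeq fun n => star (v n) := by
    rw [Metric.cauchySeq_iff'] at hv ⊢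
    intro ε hε
    obtain ⟨N, hN⟩ := hv ε hε
    exact ⟨N, fun n hn => by
      rw [dist_eq_norm, ← star_sub, norm_star, ← dist_eq_norm]; exact hN n hn⟩
  obtain ⟨T, hT⟩ := cauchySeq_tendsto_of_complete (hiso.uniformContinuous.comp_cauchySeq hv)
  obtain ⟨S, hS⟩ := cauchySeq_tendsto_of_complete (hiso.uniformContinuous.comp_cauchySeq hw)
  have hTS : ∀ x y, inner A (T x) y = inner A x (S y) := fun x y => by
    have h1 : Filter.Tendsto (fun n => inner A (v n x) y) Filter.atTop
        (nhds (inner A (T x) y)) :=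
      (CStarModule.continuous_inner.tendsto (T x, y)).comp
        (((ContinuousLinearMap.apply ℂ E x).continuous.tendsto T |>.comp hT).prodMk_nhds
          tendsto_const_nhds)
    have h2 : Filter.Tendsto (fun n => inner A x (star (v n) y)) Filter.atTop
        (nhds (inner A x (S y))) :=
      (CStarModule.continuous_inner.tendsto (x, S y)).comp
        (tendsto_const_nhds.prodMk_nhds
          ((ContinuousLinearMap.apply ℂ E y).continuous.tendsto S |>.comp hS))
    exact tendsto_nhds_unique h1 (h2.congr fun n => star_inner_right _ _ _)
  exact ⟨⟨T, S, hTS⟩, (hiso.isEmbedding.tendsto_nhds_iff).2 hT⟩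

noncomputable instance : CStarAlgebra (Adjointable A E) where

lemma continuous_of_adjoint (f g : E →ₗ[ℂ] E)
    (h : ∀ x y, inner A (f x) y = inner A x (g y)) : Continuous f := by
  refine f.continuous_of_seq_closed_graph fun u x y hu hfu => ?_
  have hl : ∀ {w : ℕ → E} {a : E}, Filter.Tendsto w Filter.atTop (nhds a) → ∀ b : E,
      Filter.Tendsto (fun n => inner A (w n) b) Filter.atTop (nhds (inner A a b)) :=
    fun {w a} hw b => (CStarModule.continuous_inner.tendsto (a, b)).comp
      (hw.prodMk_nhds tendsto_const_nhds)
  refine ext_inner (A := A) fun z => ?_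
  have h3 : inner A y z = inner A (f x) z := by
    rw [h]
    exact tendsto_nhds_unique (hl hfu z) ((hl hu (g z)).congr fun n => (h (u n) z).symm)
  rw [← CStarModule.star_inner, h3, CStarModule.star_inner]

/-- A linear map that has a linear adjoint is an adjointable operator; it is automatically bounded,
by the closed graph theorem. -/
def ofLinear (f g : E →ₗ[ℂ] E) (h : ∀ x y, inner A (f x) y = inner A x (g y)) :
    Adjointable A E :=
  ⟨⟨f, continuous_of_adjoint f g h⟩, ⟨g, continuous_of_adjoint (A := A) g f fun x y => by
    rw [← CStarModule.star_inner, ← h, CStarModule.star_inner]⟩, h⟩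

lemma ofLinear_apply (f g : E →ₗ[ℂ] E) (h : ∀ x y, inner A (f x) y = inner A x (g y)) (x : E) :
    ofLinear f g h x = f x := rfl

lemma star_ofLinear_apply (f g : E →ₗ[ℂ] E) (h : ∀ x y, inner A (f x) y = inner A x (g y))
    (x : E) : star (ofLinear f g h) x = g x :=
  ext_inner (A := A) fun z => by rw [star_inner_right, ofLinear_apply, h]

end Adjointable

end Adjointable

section StochMatrix

open scoped ComplexOrder

set_option linter.unusedSectionVars false

namespace StochMatrix

variable {Ω : Type*} [Fintype Ω] [DecidableEq Ω]

/-- The entrywise square root of a matrix. -/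
noncomputable def sqrtMat (M : Matrix Ω Ω ℝ) : Matrix Ω Ω ℝ := Matrix.of fun i j => √(M i j)

/-- The matrix `M♭`, with entry `(M i j)⁻¹` where `M i j > 0` and entry `0` elsewhere. -/
noncomputable def flat (M : Matrix Ω Ω ℝ) : Matrix Ω Ω ℝ :=
  Matrix.of fun i j => if 0 < M i j then (M i j)⁻¹ else 0

/-- A real matrix, viewed as a complex one. -/
noncomputable def cpx (M : Matrix Ω Ω ℝ) : Matrix Ω Ω ℂ := M.map Complex.ofReal

variable (P : Matrix.rowStochastic ℝ Ω)

/-- The `n`-th fiber of the subproduct system of `P`: the complex matrices supported on the edges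
of `P ^ n`. For `n = 0` these are the diagonal matrices, that is, `C(Ω)`. -/
def Arv (n : ℕ) : Submodule ℂ (Matrix Ω Ω ℂ) where
  carrier := {B | ∀ i j, ¬ 0 < (P.1 ^ n) i j → B i j = 0}
  zero_mem' := fun _ _ _ => rfl
  add_mem' := fun hA hB i j h => by simp [hA i j h, hB i j h]
  smul_mem' := fun c A hA i j h => by simp [hA i j h]

/-- The subproduct map `U_{n,m}`,
`U_{n,m}(A ⊗ B) = (√(P^(n+m)))♭ * [(√(P^n) * A) · (√(P^m) * B)]`
where `*` is the entrywise product. (For `n = 0` or `m = 0` this formula gives the left and the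
right action of `C(Ω)`, see `subprod_zero_left` and `subprod_zero_right`.) -/
noncomputable def subprod (n m : ℕ) (A B : Matrix Ω Ω ℂ) : Matrix Ω Ω ℂ :=
  (cpx (flat (sqrtMat (P.1 ^ (n + m))))).hadamard
    ((cpx (sqrtMat (P.1 ^ n))).hadamard A * (cpx (sqrtMat (P.1 ^ m))).hadamard B)

/-- The formula for the adjoint of `B ↦ U_{n,m}(A ⊗ B)`. -/
noncomputable def subprodAdj (n m : ℕ) (A C : Matrix Ω Ω ℂ) : Matrix Ω Ω ℂ :=
  (cpx (sqrtMat (P.1 ^ m))).hadamard (((cpx (sqrtMat (P.1 ^ n))).hadamard A).conjTranspose *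
    (cpx (flat (sqrtMat (P.1 ^ (n + m))))).hadamard C)

/-- The coefficient of `A i k * B k l` in the entry `(i, l)` of `U_{n,m}(A ⊗ B)`. -/
noncomputable def weight (n m : ℕ) (i k l : Ω) : ℝ :=
  flat (sqrtMat (P.1 ^ (n + m))) i l * (sqrtMat (P.1 ^ n) i k * sqrtMat (P.1 ^ m) k l)

lemma subprod_apply (n m : ℕ) (A B : Matrix Ω Ω ℂ) (i l : Ω) :
    subprod P n m A B i l = ∑ k, (weight P n m i k l : ℂ) * (A i k * B k l) := by
  simp only [subprod, Matrix.hadamard_apply, Matrix.mul_apply, Finset.mul_sum, cpx,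
    Matrix.map_apply, weight, Complex.ofReal_mul]
  exact Finset.sum_congr rfl fun _ _ => by ring

lemma subprodAdj_apply (n m : ℕ) (A C : Matrix Ω Ω ℂ) (k l : Ω) :
    subprodAdj P n m A C k l = ∑ i, (weight P n m i k l : ℂ) * (star (A i k) * C i l) := by
  simp only [subprodAdj, Matrix.hadamard_apply, Matrix.mul_apply, Finset.mul_sum, cpx,
    Matrix.map_apply, weight, Complex.ofReal_mul, Matrix.conjTranspose_apply, star_mul',
    Complex.star_def, Complex.conj_ofReal]
  exact Finset.sum_congr rfl fun _ _ => by ring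

lemma pow_nonneg (n : ℕ) (i j : Ω) : 0 ≤ (P.1 ^ n) i j :=
  Matrix.nonneg_of_mem_rowStochastic (pow_mem P.2 n)

lemma weight_nonneg (n m : ℕ) (i k l : Ω) : 0 ≤ weight P n m i k l := by
  unfold weight flat sqrtMat
  simp only [Matrix.of_apply]
  split_ifs <;> positivity

lemma weight_le_one (n m : ℕ) (i k l : Ω) : weight P n m i k l ≤ 1 := by
  have e : weight P n m i k l = (if 0 < √((P.1 ^ (n + m)) i l) then (√((P.1 ^ (n + m)) i l))⁻¹
    else 0) * (√((P.1 ^ n) i k) * √((P.1 ^ m) k l)) := rfl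
  rw [e]
  by_cases h : 0 < √((P.1 ^ (n + m)) i l)
  · rw [if_pos h, inv_mul_le_one₀ h, ← Real.sqrt_mul (pow_nonneg P n i k)]
    apply Real.sqrt_le_sqrt
    rw [pow_add, Matrix.mul_apply]
    exact Finset.single_le_sum (f := fun k => (P.1 ^ n) i k * (P.1 ^ m) k l)
      (fun k _ => mul_nonneg (pow_nonneg P n i k) (pow_nonneg P m k l)) (Finset.mem_univ k)
  · rw [if_neg h]; simp

lemma norm_sum_weight_sq_le (w : Ω → ℝ) (hw : ∀ k, 0 ≤ w k) (hw1 : ∀ k, w k ≤ 1) (a b : Ω → ℂ) :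
    ‖∑ k, (w k : ℂ) * (a k * b k)‖ ^ 2 ≤ (∑ k, ‖a k‖ ^ 2) * ∑ k, ‖b k‖ ^ 2 := by
  calc _ ≤ (∑ k, ‖a k‖ * ‖b k‖) ^ 2 := by
        gcongr
        refine (norm_sum_le _ _).trans (Finset.sum_le_sum fun k _ => ?_)
        rw [norm_mul, norm_mul, Complex.norm_real, Real.norm_of_nonneg (hw k)]
        exact mul_le_of_le_one_left (by positivity) (hw1 k)
    _ ≤ _ := Finset.sum_mul_sq_le_sq_mul_sq _ _ _

lemma subprod_mem (n m : ℕ) (A B : Matrix Ω Ω ℂ) : subprod P n m A B ∈ Arv P (n + m) := by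
  intro i j h
  have : √((P.1 ^ (n + m)) i j) = 0 := Real.sqrt_eq_zero'.2 (not_lt.1 h)
  simp [subprod, flat, cpx, sqrtMat, this]

/-- The positions in the `j`-th column: the pairs `(n, i)` such that `(i, j)` is an edge of
`P ^ n`. -/
abbrev Col (j : Ω) : Type _ := {x : ℕ × Ω // 0 < (P.1 ^ x.1) x.2 j}

/-- The Fock correspondence `⨁ₙ Arv(P)ₙ`: the sequences of matrices `ξₙ ∈ Arv(P)ₙ` such that
`∑ₙ ⟨ξₙ, ξₙ⟩` converges in `C(Ω)`. Since `⟨ξₙ, ξₙ⟩ j = ∑ᵢ |ξₙ i j|²`, such a sequence amounts to a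
square-summable family `(n, i) ↦ ξₙ i j` for each column `j`. The norm is the maximum of the
`ℓ²`-norms of the columns, and `C(Ω)` acts on the right by `(ξ · a) j = a j • ξ j`. -/
abbrev Fock : Type _ := (j : Ω) → lp (fun _ : Col P j => ℂ) 2

variable {P}

/-- The `C(Ω)`-valued inner product of the Fock correspondence,
`⟨ξ, η⟩ = ∑ₙ Diag(ξₙ* ηₙ)`, see `inner_eq`. -/
noncomputable instance : CStarModule (Ω → ℂ) (Fock P) where
  inner ξ η := fun j => inner ℂ (ξ j) (η j)
  inner_add_right {x y z} := by ext j; simp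
  inner_self_nonneg {x} := fun j => by simp
  inner_self {x} := by simp [funext_iff]
  inner_op_smul_right {a x y} := by ext j; simp
  inner_smul_right_complex {z x y} := by ext j; simp
  star_inner x y := by ext j; simp
  norm_eq_sqrt_norm_inner_self x := by
    have h : ∀ j, ‖inner ℂ (x j) (x j)‖ = ‖x j‖ ^ 2 := fun j => by
      rw [inner_self_eq_norm_sq_to_K]; simp
    refine le_antisymm ((pi_norm_le_iff_of_nonneg (Real.sqrt_nonneg _)).2 fun j => ?_) ?_
    · refine Real.le_sqrt_of_sq_le ?_
      rw [← h]
      exact norm_le_pi_norm (fun j => inner ℂ (x j) (x j)) j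
    · refine Real.sqrt_le_iff.2 ⟨norm_nonneg _, (pi_norm_le_iff_of_nonneg (by positivity)).2
        fun j => ?_⟩
      rw [h]
      gcongr
      exact norm_le_pi_norm x j

/-- The component `ξₙ ∈ Arv(P)ₙ` of `ξ` in the Fock correspondence. -/
noncomputable def component (ξ : Fock P) (n : ℕ) : Matrix Ω Ω ℂ :=
  Matrix.of fun i j => if h : 0 < (P.1 ^ n) i j then ξ j ⟨(n, i), h⟩ else 0

lemma component_mem (ξ : Fock P) (n : ℕ) : component ξ n ∈ Arv P n := fun i j h => by
  simp [component, h]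

@[simp] lemma component_coe (ξ : Fock P) (j : Ω) (x : Col P j) :
    component ξ x.1.1 x.1.2 j = ξ j x := by
  simp [component, x.2]

lemma component_add (ξ η : Fock P) : component (ξ + η) = component ξ + component η := by
  ext n i j
  by_cases h : 0 < (P.1 ^ n) i j <;> simp [component, h]

lemma component_smul (c : ℂ) (ξ : Fock P) : component (c • ξ) = c • component ξ := by
  ext n i j
  by_cases h : 0 < (P.1 ^ n) i j <;> simp [component, h]

lemma component_injective : Function.Injective (component (P := P)) := fun ξ η h => by
  ext j x
  rw [← component_coe, h, component_coe]

/-- A sequence of matrices is square-summable. -/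
def SqSummable (c : ℕ → Matrix Ω Ω ℂ) : Prop := ∀ i j, Summable fun n => ‖c n i j‖ ^ 2

lemma sqSummable_component (ξ : Fock P) : SqSummable (component ξ) := fun i j => by
  have h := (memℓp_gen_iff (p := 2) (by simp)).1 (lp.memℓp (ξ j))
  simp only [ENNReal.toReal_ofNat, Real.rpow_ofNat] at h
  have h2 : Summable fun x : ℕ × Ω => ‖component ξ x.1 x.2 j‖ ^ 2 := by
    refine (Subtype.val_injective.summable_iff fun x hx => ?_).1
      (h.congr fun x => ?_)
    · rw [component_mem ξ x.1 x.2 j (fun h => hx ⟨⟨x, h⟩, rfl⟩)]; simp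
    · simp
  exact h2.comp_injective (i := fun n : ℕ => (n, i)) fun a b hab => (Prod.ext_iff.1 hab).1

/-- The element of the Fock correspondence with given square-summable components. -/
noncomputable def ofComponents (c : ℕ → Matrix Ω Ω ℂ) (hc : SqSummable c) : Fock P := fun j =>
  ⟨fun x => c x.1.1 x.1.2 j, by
    refine (memℓp_gen_iff (p := 2) (by simp)).2 ?_
    simp only [ENNReal.toReal_ofNat, Real.rpow_ofNat]
    have h : Summable fun x : ℕ × Ω => ‖c x.1 x.2 j‖ ^ 2 := by
      refine (summable_prod_of_nonneg fun x => by positivity).2 ⟨fun n => .of_finite, ?_⟩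
      simp only [tsum_fintype]
      exact summable_sum fun i _ => hc i j
    exact h.comp_injective (i := fun x : Col P j => x.1) Subtype.val_injective⟩

lemma component_ofComponents (c : ℕ → Matrix Ω Ω ℂ) (hc : SqSummable c) (hs : ∀ n, c n ∈ Arv P n) :
    component (ofComponents c hc : Fock P) = c := by
  ext n i j
  by_cases h : 0 < (P.1 ^ n) i j
  · simp [component, h, ofComponents]
  · simp [component, h, hs n i j h]

/-- The inner product is `⟨ξ, η⟩ = ∑ₙ Diag(ξₙ* ηₙ)`. -/
lemma inner_eq (ξ η : Fock P) (j : Ω) : (inner (Ω → ℂ) ξ η) j =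
    ∑' n, ((component ξ n).conjTranspose * component η n) j j := by
  change inner ℂ (ξ j) (η j) = _
  let F : ℕ × Ω → ℂ := fun x => star (component ξ x.1 x.2 j) * component η x.1 x.2 j
  have hF : ∀ x : Col P j, inner ℂ (ξ j x) (η j x) = F x.1 := fun x => by
    simp [F, mul_comm]
  have hz : ∀ x ∉ Set.range (Subtype.val : Col P j → ℕ × Ω), F x = 0 := fun x hx => by
    simp only [F]
    rw [component_mem ξ x.1 x.2 j (fun h => hx ⟨⟨x, h⟩, rfl⟩)]; simp
  have hs : Summable F := (Subtype.val_injective.summable_iff hz).1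
    ((lp.summable_inner (𝕜 := ℂ) (ξ j) (η j)).congr hF)
  rw [lp.inner_eq_tsum, tsum_congr hF,
    Subtype.val_injective.tsum_eq (Function.support_subset_iff'.2 hz), hs.tsum_prod]
  simp [F, Matrix.mul_apply, tsum_fintype]

/-- The linear map on the Fock correspondence that acts on the sequences of components by `f`. -/
noncomputable def linOfComponents (f : (ℕ → Matrix Ω Ω ℂ) →ₗ[ℂ] (ℕ → Matrix Ω Ω ℂ))
    (hf : ∀ c, SqSummable c → SqSummable (f c))
    (hfm : ∀ c, (∀ n, c n ∈ Arv P n) → ∀ n, f c n ∈ Arv P n) : Fock P →ₗ[ℂ] Fock P where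
  toFun ξ := ofComponents (f (component ξ)) (hf _ (sqSummable_component ξ))
  map_add' ξ η := component_injective <| by
    rw [component_ofComponents _ _ (hfm _ (component_mem _)), component_add, component_add,
      component_ofComponents _ _ (hfm _ (component_mem _)),
      component_ofComponents _ _ (hfm _ (component_mem _)), map_add]
  map_smul' a ξ := component_injective <| by
    rw [component_ofComponents _ _ (hfm _ (component_mem _)), component_smul, component_smul,
      component_ofComponents _ _ (hfm _ (component_mem _)), map_smul]
    rfl

lemma component_linOfComponents (f : (ℕ → Matrix Ω Ω ℂ) →ₗ[ℂ] (ℕ → Matrix Ω Ω ℂ))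
    (hf : ∀ c, SqSummable c → SqSummable (f c))
    (hfm : ∀ c, (∀ n, c n ∈ Arv P n) → ∀ n, f c n ∈ Arv P n) (ξ : Fock P) :
    component (linOfComponents f hf hfm ξ) = f (component ξ) :=
  component_ofComponents _ (hf _ (sqSummable_component ξ)) (hfm _ (component_mem _))

/-- The adjointable operator on the Fock correspondence that acts on the sequences of components by
`f`, and whose adjoint acts by `g`. -/
noncomputable def opOfComponents (f g : (ℕ → Matrix Ω Ω ℂ) →ₗ[ℂ] (ℕ → Matrix Ω Ω ℂ))
    (hf : ∀ c, SqSummable c → SqSummable (f c)) (hg : ∀ c, SqSummable c → SqSummable (g c))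
    (hfm : ∀ c, (∀ n, c n ∈ Arv P n) → ∀ n, f c n ∈ Arv P n)
    (hgm : ∀ c, (∀ n, c n ∈ Arv P n) → ∀ n, g c n ∈ Arv P n)
    (h : ∀ c d j, ∑' n, ((f c n).conjTranspose * d n) j j =
      ∑' n, ((c n).conjTranspose * g d n) j j) :
    Adjointable (Ω → ℂ) (Fock P) :=
  Adjointable.ofLinear (linOfComponents f hf hfm) (linOfComponents g hg hgm) fun ξ η =>
    funext fun j => by
      rw [inner_eq, inner_eq, component_linOfComponents, component_linOfComponents, h]

lemma component_opOfComponents (f g : (ℕ → Matrix Ω Ω ℂ) →ₗ[ℂ] (ℕ → Matrix Ω Ω ℂ))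
    (hf hg hfm hgm h) (ξ : Fock P) :
    component (opOfComponents (P := P) f g hf hg hfm hgm h ξ) = f (component ξ) :=
  component_linOfComponents f hf hfm ξ

lemma component_star_opOfComponents (f g : (ℕ → Matrix Ω Ω ℂ) →ₗ[ℂ] (ℕ → Matrix Ω Ω ℂ))
    (hf hg hfm hgm h) (ξ : Fock P) :
    component (star (opOfComponents (P := P) f g hf hg hfm hgm h) ξ) = g (component ξ) := by
  rw [opOfComponents, Adjointable.star_ofLinear_apply, component_linOfComponents]

variable (P)

/-- The shift by `A` on sequences of components. -/
noncomputable def shiftSeq (n : ℕ) (A : Matrix Ω Ω ℂ) :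
    (ℕ → Matrix Ω Ω ℂ) →ₗ[ℂ] (ℕ → Matrix Ω Ω ℂ) where
  toFun c := fun N => if n ≤ N then subprod P n (N - n) A (c (N - n)) else 0
  map_add' c d := by
    ext N i j
    by_cases h : n ≤ N <;> simp [h, subprod_apply, mul_add, Finset.sum_add_distrib]
  map_smul' a c := by
    ext N i j
    by_cases h : n ≤ N <;> simp [h, subprod_apply, Finset.mul_sum, mul_left_comm]

/-- The adjoint of the shift by `A` on sequences of components. -/
noncomputable def shiftAdjSeq (n : ℕ) (A : Matrix Ω Ω ℂ) :
    (ℕ → Matrix Ω Ω ℂ) →ₗ[ℂ] (ℕ → Matrix Ω Ω ℂ) where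
  toFun c := fun m => subprodAdj P n m A (c (n + m))
  map_add' c d := by
    ext N i j
    simp [subprodAdj_apply, mul_add, Finset.sum_add_distrib]
  map_smul' a c := by
    ext N i j
    simp [subprodAdj_apply, Finset.mul_sum, mul_left_comm]

lemma shiftSeq_apply (n : ℕ) (A : Matrix Ω Ω ℂ) (c : ℕ → Matrix Ω Ω ℂ) (N : ℕ) :
    shiftSeq P n A c N = if n ≤ N then subprod P n (N - n) A (c (N - n)) else 0 := rfl

lemma shiftAdjSeq_apply (n : ℕ) (A : Matrix Ω Ω ℂ) (c : ℕ → Matrix Ω Ω ℂ) (m : ℕ) :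
    shiftAdjSeq P n A c m = subprodAdj P n m A (c (n + m)) := rfl

lemma sqSummable_shiftSeq (n : ℕ) (A : Matrix Ω Ω ℂ) (c : ℕ → Matrix Ω Ω ℂ) (hc : SqSummable c) :
    SqSummable (shiftSeq P n A c) := fun i j => by
  rw [← summable_nat_add_iff n]
  simp only [shiftSeq_apply, Nat.le_add_left, if_true, Nat.add_sub_cancel, subprod_apply]
  exact Summable.of_nonneg_of_le (fun _ => by positivity)
    (fun m => norm_sum_weight_sq_le _ (fun k => weight_nonneg P n m i k j)
      (fun k => weight_le_one P n m i k j) _ _)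
    ((summable_sum fun k _ => hc k j).mul_left _)

lemma sqSummable_shiftAdjSeq (n : ℕ) (A : Matrix Ω Ω ℂ) (c : ℕ → Matrix Ω Ω ℂ)
    (hc : SqSummable c) : SqSummable (shiftAdjSeq P n A c) := fun k j => by
  simp only [shiftAdjSeq_apply, subprodAdj_apply]
  exact Summable.of_nonneg_of_le (fun _ => by positivity)
    (fun m => norm_sum_weight_sq_le _ (fun i => weight_nonneg P n m i k j)
      (fun i => weight_le_one P n m i k j) _ _)
    ((summable_sum fun i _ => by
      simpa only [add_comm n] using (summable_nat_add_iff n).2 (hc i j)).mul_left _)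

lemma shiftSeq_mem (n : ℕ) (A : Matrix Ω Ω ℂ) (c : ℕ → Matrix Ω Ω ℂ) (N : ℕ) :
    shiftSeq P n A c N ∈ Arv P N := by
  rw [shiftSeq_apply]
  split_ifs with h
  · have := subprod_mem P n (N - n) A (c (N - n))
    rwa [Nat.add_sub_cancel' h] at this
  · exact zero_mem _

lemma shiftAdjSeq_mem (n : ℕ) (A : Matrix Ω Ω ℂ) (c : ℕ → Matrix Ω Ω ℂ) (m : ℕ) :
    shiftAdjSeq P n A c m ∈ Arv P m := by
  intro i j h
  have : √((P.1 ^ m) i j) = 0 := Real.sqrt_eq_zero'.2 (not_lt.1 h)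
  simp [shiftAdjSeq_apply, subprodAdj, cpx, sqrtMat, this]

lemma tsum_shiftSeq (n : ℕ) (A : Matrix Ω Ω ℂ) (c d : ℕ → Matrix Ω Ω ℂ) (j : Ω) :
    ∑' N, ((shiftSeq P n A c N).conjTranspose * d N) j j =
      ∑' m, ((c m).conjTranspose * shiftAdjSeq P n A d m) j j := by
  rw [← (add_right_injective n).tsum_eq (f := fun N =>
    ((shiftSeq P n A c N).conjTranspose * d N) j j)]
  · refine tsum_congr fun m => ?_
    simp only [shiftSeq_apply, shiftAdjSeq_apply, Nat.le_add_right,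
      if_true, Nat.add_sub_cancel_left, Matrix.mul_apply, Matrix.conjTranspose_apply,
      subprod_apply, subprodAdj_apply, Finset.mul_sum, star_sum, Finset.sum_mul]
    rw [Finset.sum_comm]
    refine Finset.sum_congr rfl fun k _ => Finset.sum_congr rfl fun i _ => ?_
    simp only [star_mul', Complex.star_def, Complex.conj_ofReal]
    ring
  · refine Function.support_subset_iff'.2 fun N hN => ?_
    have : ¬ n ≤ N := fun h => hN ⟨N - n, Nat.add_sub_cancel' h⟩
    simp [shiftSeq_apply, this]

/-- The shift operator `S_A^{(n)}`, determined by `S_A^{(n)}(B) = U_{n,m}(A ⊗ B)` for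
`B ∈ Arv(P)ₘ`, see `component_shift`. -/
noncomputable def shift (n : ℕ) (A : Matrix Ω Ω ℂ) : Adjointable (Ω → ℂ) (Fock P) :=
  opOfComponents (shiftSeq P n A) (shiftAdjSeq P n A) (sqSummable_shiftSeq P n A)
    (sqSummable_shiftAdjSeq P n A) (fun c _ => shiftSeq_mem P n A c)
    (fun c _ => shiftAdjSeq_mem P n A c) (tsum_shiftSeq P n A)

/-- The shift maps `B ∈ Arv(P)ₘ` to `U_{n,m}(A ⊗ B) ∈ Arv(P)ₙ₊ₘ`. -/
lemma component_shift (n m : ℕ) (A : Matrix Ω Ω ℂ) (ξ : Fock P) :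
    component (shift P n A ξ) (n + m) = subprod P n m A (component ξ m) := by
  rw [shift, component_opOfComponents]
  simp [shiftSeq_apply]

lemma component_shift_of_lt {n N : ℕ} (h : N < n) (A : Matrix Ω Ω ℂ) (ξ : Fock P) :
    component (shift P n A ξ) N = 0 := by
  rw [shift, component_opOfComponents]
  simp [shiftSeq_apply, not_le.2 h]

lemma component_star_shift (n m : ℕ) (A : Matrix Ω Ω ℂ) (ξ : Fock P) :
    component (star (shift P n A) ξ) m = subprodAdj P n m A (component ξ (n + m)) := by
  rw [shift, component_star_opOfComponents]
  rfl

lemma weight_zero_left (m : ℕ) (i k l : Ω) (h : 0 < (P.1 ^ m) i l) :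
    weight P 0 m i k l = if k = i then 1 else 0 := by
  have h' := (Real.sqrt_pos.2 h)
  by_cases hk : k = i
  · subst hk; simp [weight, flat, sqrtMat, h, h'.ne']
  · simp [weight, flat, sqrtMat, hk, Ne.symm hk]

lemma weight_zero_right (n : ℕ) (i k l : Ω) (h : 0 < (P.1 ^ n) i l) :
    weight P n 0 i k l = if k = l then 1 else 0 := by
  have h' := (Real.sqrt_pos.2 h)
  by_cases hk : k = l
  · subst hk; simp [weight, flat, sqrtMat, h, h'.ne']
  · simp [weight, flat, sqrtMat, hk]

/-- `U_{0,m}` is the left action of `C(Ω)`. -/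
lemma subprod_zero_left (m : ℕ) (a : Ω → ℂ) {B : Matrix Ω Ω ℂ} (hB : B ∈ Arv P m) :
    subprod P 0 m (Matrix.diagonal a) B = Matrix.diagonal a * B := by
  ext i l
  by_cases h : 0 < (P.1 ^ m) i l
  · simp only [subprod_apply, weight_zero_left P m i _ l h, Matrix.diagonal_mul]
    rw [Finset.sum_eq_single i (fun k _ hk => by simp [hk]) (by simp)]
    simp
  · rw [subprod_mem P 0 m _ B i l (by simpa using h)]
    simp [hB i l h]

/-- `U_{n,0}` is the right action of `C(Ω)`. -/
lemma subprod_zero_right (n : ℕ) (a : Ω → ℂ) {A : Matrix Ω Ω ℂ} (hA : A ∈ Arv P n) :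
    subprod P n 0 A (Matrix.diagonal a) = A * Matrix.diagonal a := by
  ext i l
  by_cases h : 0 < (P.1 ^ n) i l
  · simp only [subprod_apply, weight_zero_right P n i _ l h, Matrix.mul_diagonal]
    rw [Finset.sum_eq_single l (fun k _ hk => by simp [hk]) (by simp)]
    simp
  · rw [subprod_mem P n 0 A _ i l (by simpa using h)]
    simp [hA i l h]

/-- The left action of `a ∈ C(Ω)` on the Fock correspondence: on each fiber, left multiplication by
the diagonal matrix `a`, see `component_leftAction`. -/
noncomputable def leftAction (a : Ω → ℂ) : Adjointable (Ω → ℂ) (Fock P) :=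
  shift P 0 (Matrix.diagonal a)

lemma component_leftAction (a : Ω → ℂ) (ξ : Fock P) (m : ℕ) :
    component (leftAction P a ξ) m = Matrix.diagonal a * component ξ m := by
  rw [leftAction, ← subprod_zero_left P m a (component_mem ξ m), ← component_shift, zero_add]

/-- The projection onto the `n`-th term on sequences of components. -/
def projSeq (n : ℕ) : (ℕ → Matrix Ω Ω ℂ) →ₗ[ℂ] (ℕ → Matrix Ω Ω ℂ) where
  toFun c := fun N => if N = n then c N else 0
  map_add' c d := by ext N; by_cases h : N = n <;> simp [h]
  map_smul' a c := by ext N; by_cases h : N = n <;> simp [h]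

lemma projSeq_apply (n : ℕ) (c : ℕ → Matrix Ω Ω ℂ) (N : ℕ) :
    projSeq n c N = if N = n then c N else 0 := rfl

lemma sqSummable_projSeq (n : ℕ) (c : ℕ → Matrix Ω Ω ℂ) : SqSummable (projSeq n c) := fun i j =>
  summable_of_ne_finset_zero (s := {n}) fun N hN => by
    simp [projSeq_apply, show N ≠ n by simpa using hN]

lemma projSeq_mem (n : ℕ) (c : ℕ → Matrix Ω Ω ℂ) (hc : ∀ N, c N ∈ Arv P N) (N : ℕ) :
    projSeq n c N ∈ Arv P N := by
  rw [projSeq_apply]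
  split_ifs
  exacts [hc N, zero_mem _]

/-- The projection `Qₙ` of the Fock correspondence onto its `n`-th fiber. -/
noncomputable def fiberProj (n : ℕ) : Adjointable (Ω → ℂ) (Fock P) :=
  opOfComponents (projSeq n) (projSeq n) (fun c _ => sqSummable_projSeq n c)
    (fun c _ => sqSummable_projSeq n c) (projSeq_mem P n) (projSeq_mem P n) fun c d j =>
      tsum_congr fun N => by by_cases h : N = n <;> simp [projSeq_apply, h]

lemma component_fiberProj (n N : ℕ) (ξ : Fock P) :
    component (fiberProj P n ξ) N = if N = n then component ξ N else 0 := by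
  rw [fiberProj, component_opOfComponents, projSeq_apply]

/-- The generators of the tensor and Toeplitz algebras: the copy of `C(Ω)` and all shifts. -/
def generators : Set (Adjointable (Ω → ℂ) (Fock P)) :=
  Set.range (leftAction P) ∪ {T | ∃ n, ∃ A ∈ Arv P n, T = shift P n A}

/-- The Toeplitz algebra `T(P)`: the C*-algebra generated by `C(Ω)` and all shifts. -/
noncomputable def toeplitz : StarSubalgebra ℂ (Adjointable (Ω → ℂ) (Fock P)) :=
  (StarAlgebra.adjoin ℂ (generators P)).topologicalClosure

/-- The tensor algebra `T₊(P)`: the norm-closed algebra generated by `C(Ω)` and all shifts. -/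
noncomputable def tensorAlgebra : Subalgebra ℂ (Adjointable (Ω → ℂ) (Fock P)) :=
  (Algebra.adjoin ℂ (generators P)).topologicalClosure

lemma tensorAlgebra_le : tensorAlgebra P ≤ (toeplitz P).toSubalgebra :=
  Subalgebra.topologicalClosure_mono
    (Algebra.adjoin_le (StarAlgebra.subset_adjoin ℂ (generators P)))

instance : IsClosed (toeplitz P : Set (Adjointable (Ω → ℂ) (Fock P))) :=
  StarSubalgebra.isClosed_topologicalClosure _

noncomputable instance : CStarAlgebra (toeplitz P) := inferInstance

noncomputable instance : PartialOrder (toeplitz P) := CStarAlgebra.spectralOrder _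

instance : StarOrderedRing (toeplitz P) := CStarAlgebra.spectralOrderedRing _

/-- The tensor algebra `T₊(P)`, as a subalgebra of the Toeplitz algebra `T(P)`. -/
noncomputable def tensorSub : Subalgebra ℂ (toeplitz P) :=
  (tensorAlgebra P).comap (toeplitz P).subtype.toAlgHom

/-- The Cuntz–Pimsner ideal `J(P) = {T ∈ T(P) : ‖T Qₙ‖ → 0}` (it is in fact two-sided). -/
def cuntzPimsnerIdeal : Ideal (toeplitz P) where
  carrier := {T | Filter.Tendsto (fun n => ‖(T : Adjointable (Ω → ℂ) (Fock P)) * fiberProj P n‖)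
    Filter.atTop (nhds 0)}
  zero_mem' := by simp
  add_mem' := fun {S T} hS hT => by
    refine squeeze_zero (fun _ => norm_nonneg _) (fun n => ?_) (by simpa using hS.add hT)
    simpa [add_mul] using norm_add_le (S.1 * fiberProj P n) (T.1 * fiberProj P n)
  smul_mem' := fun S T hT => by
    refine squeeze_zero (fun _ => norm_nonneg _) (fun n => ?_)
      (by simpa using hT.const_mul ‖(S : Adjointable (Ω → ℂ) (Fock P))‖)
    simpa [mul_assoc] using norm_mul_le S.1 (T.1 * fiberProj P n)

end StochMatrix

end StochMatrix

section UniqueExtension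

universe u v w

variable {B : Type u} [CStarAlgebra B] [PartialOrder B] [StarOrderedRing B]
  {H : Type v} [NormedAddCommGroup H] [InnerProductSpace ℂ H] [CompleteSpace H]

namespace OpAlg

/-- The linear map `φ : A → B(H)` on a subalgebra `A` of a C*-algebra `B` is unital and completely
contractive. The norm of a matrix over `A` is its norm as a matrix over `B`. -/
def IsUCC (A : Subalgebra ℂ B) (φ : A →ₗ[ℂ] (H →L[ℂ] H)) : Prop :=
  φ 1 = 1 ∧ ∀ (n : ℕ) (M : CStarMatrix (Fin n) (Fin n) A),
    ‖M.map φ‖ ≤ ‖M.map ((↑) : A → B)‖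

open scoped CStarAlgebra in
/-- The unital completely contractive map `φ : A → B(H)` has the unique extension property: it has
exactly one extension to a unital completely positive map on `B`, and this extension is a
*-representation. -/
def HasUEP (A : Subalgebra ℂ B) (φ : A →ₗ[ℂ] (H →L[ℂ] H)) : Prop :=
  IsUCC A φ ∧ ∃ π : B →⋆ₐ[ℂ] (H →L[ℂ] H), (∀ a : A, π a = φ a) ∧
    ∀ ψ : B →CP (H →L[ℂ] H), ψ 1 = 1 → (∀ a : A, ψ a = φ a) → ∀ b, ψ b = π b

/-- The unital completely contractive map `φ : A → B(H)` is maximal: whenever a unital completely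
contractive `φ' : A → B(K)` dilates it, `φ = V* φ' V` for an isometry `V : H → K`, then
`φ' = φ ⊕ ψ` with respect to `K = V H ⊕ (V H)ᗮ` for some unital completely contractive `ψ`. -/
def IsMaximal (A : Subalgebra ℂ B) (φ : A →ₗ[ℂ] (H →L[ℂ] H)) : Prop :=
  IsUCC A φ ∧ ∀ (K : Type w) [NormedAddCommGroup K] [InnerProductSpace ℂ K] [CompleteSpace K]
    (V : H →ₗᵢ[ℂ] K) (φ' : A →ₗ[ℂ] (K →L[ℂ] K)), IsUCC A φ' →
    (∀ a, φ a = V.toContinuousLinearMap.adjoint ∘L φ' a ∘L V.toContinuousLinearMap) →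
    ∃ ψ : A →ₗ[ℂ] (V.toLinearMap.rangeᗮ →L[ℂ] V.toLinearMap.rangeᗮ), IsUCC A ψ ∧
      ∀ (a : A) (h : H) (l : V.toLinearMap.rangeᗮ), φ' a (V h + l) = V (φ a h) + ψ a l

/-- The restriction to the subalgebra `A` of a *-representation of `B`. -/
noncomputable def restrictRep (A : Subalgebra ℂ B) (ρ : B →⋆ₐ[ℂ] (H →L[ℂ] H)) :
    A →ₗ[ℂ] (H →L[ℂ] H) :=
  (ρ : B →ₗ[ℂ] (H →L[ℂ] H)) ∘ₗ A.val.toLinearMap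

end OpAlg

end UniqueExtension

universe u v w

namespace OpAlg

/-! Write `p_j` for the vertex projections and `S = S^{(n)}_{E_ij}` for the shift by a matrix unit.
Both halves of the theorem rest on two facts about these shifts. For fixed `n`, the sum of all `S
S*` is the projection onto the levels `≥ n`, so `ρ` sends it to `1`. And `S* S` acts diagonally: on
the entry `(j, b)` of level `N` it multiplies by `P^n i j * P^N j b / P^(n+N) i b`. By the ergodic
theorem for irreducible chains, the positive entries in column `b` of `P^N` approach a positive
limit depending only on `b`, so this factor tends to `P^n i j`. Hence `S* S` equals `q = P^n i j •
p_j` modulo the Cuntz–Pimsner ideal, and `q` lies in the tensor algebra. Moreover, for every `ε > 0`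
there is a row of shifts `t`, of a high enough degree `M`, with `S* S + ∑ t t* ≤ 1 + ε + q`: from
level `M` on, `S* S` exceeds `q` by at most `ε`, while below `M` the slack `1 - ∑ t t*` dominates
the contraction `S* S`.

`OpAlg.IsRigidFamily` abstracts this situation. Let `φ'` dilate `φ` through `V`. Applying the
Schwarz inequality to a row `t` gives `∑ ‖φ'(t)* V h‖² ≤ ‖h‖² = ∑ ‖ρ(t)* h‖²`. Since `V* φ'(t)* V =
ρ(t)*`, no term on the left is smaller than its partner, so all are equal and `φ'(t)* V h = V ρ(t)*
h`. The same inequality for `S* S + ∑ t t* ≤ 1 + ε + q` now leaves `‖φ'(S) V h‖² ≤ ‖ρ(S) h‖² + ε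
‖h‖²`, whence `φ'(S) V h = V ρ(S) h`. Thus `V H` reduces `φ'`. For a completely positive extension
`ψ` the same estimates force equality in the Schwarz inequality at `S` and `S*`, which puts both in
the multiplicative domain, so `ψ = ρ`.

The Schwarz inequality for `φ'` (`IsUCC.sum_norm_sq_le`) is obtained without extending `φ'` to a
completely positive map. A unital completely contractive map preserves accretive matrices, and
suitable matrices over the algebra itself encode the inequality. -/

lemma exists_eq_star_mul_self {B : Type*} [CStarAlgebra B] [PartialOrder B] [StarOrderedRing B]
    {b : B} (hb : 0 ≤ b) : ∃ z, b = star z * z :=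
  CStarAlgebra.nonneg_iff_eq_star_mul_self.1 hb

/-! ### Matrices over `B(K)`, and complete accretivity of unital completely contractive maps -/

section MatrixVectors

open scoped InnerProductSpace

variable {K : Type*} [NormedAddCommGroup K] [InnerProductSpace ℂ K] [CompleteSpace K]

lemma sum_inner_star_mul_self {n : Type*} [Fintype n]
    (Z : CStarMatrix n n (K →L[ℂ] K)) (x : n → K) :
    ∑ i, ∑ j, ⟪x i, (star Z * Z) i j (x j)⟫_ℂ = ((∑ k, ‖∑ j, Z k j (x j)‖ ^ 2 : ℝ) : ℂ) := by
  have h : ∀ k, ((‖∑ j, Z k j (x j)‖ ^ 2 : ℝ) : ℂ) =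
      ∑ i, ∑ j, ⟪Z k i (x i), Z k j (x j)⟫_ℂ := fun k => by
    have h0 := inner_self_eq_norm_sq_to_K (𝕜 := ℂ) (∑ j, Z k j (x j))
    rw [sum_inner] at h0
    simp only [inner_sum] at h0
    rw [h0]
    simp
  rw [Complex.ofReal_sum, Finset.sum_congr rfl fun k _ => h k, Finset.sum_comm]
  conv_rhs => rw [Finset.sum_comm]
  rw [Finset.sum_comm]
  refine Finset.sum_congr rfl fun i _ => ?_
  rw [Finset.sum_comm]
  refine Finset.sum_congr rfl fun j _ => ?_
  simp [CStarMatrix.mul_apply, CStarMatrix.star_apply,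
    ContinuousLinearMap.star_eq_adjoint, ContinuousLinearMap.adjoint_inner_right]

variable {n : Type*} [Fintype n] [DecidableEq n]

lemma sum_re_inner_nonneg {N : CStarMatrix n n (K →L[ℂ] K)} (hN : 0 ≤ N) (x : n → K) :
    0 ≤ ∑ i, ∑ j, (⟪x i, N i j (x j)⟫_ℂ).re := by
  obtain ⟨Z, rfl⟩ := exists_eq_star_mul_self hN
  have := congrArg Complex.re (sum_inner_star_mul_self Z x)
  simp only [Complex.re_sum, Complex.ofReal_re] at this
  rw [this]
  positivity

/-- The abstract C*-norm of a matrix bounds its action on `Kⁿ`, because `‖N‖² - N* N ≥ 0` can be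
tested on vectors. -/
lemma sum_norm_sq_apply_le (N : CStarMatrix n n (K →L[ℂ] K)) (x : n → K) :
    ∑ i, ‖∑ j, N i j (x j)‖ ^ 2 ≤ ‖N‖ ^ 2 * ∑ j, ‖x j‖ ^ 2 := by
  have h := sum_re_inner_nonneg
    (sub_nonneg.2 (CStarAlgebra.star_mul_le_algebraMap_norm_sq (a := N))) x
  have h' := congrArg Complex.re (sum_inner_star_mul_self N x)
  simp only [Complex.re_sum, Complex.ofReal_re] at h'
  simp only [CStarMatrix.sub_apply, sub_apply, inner_sub_right,
    Complex.sub_re, Finset.sum_sub_distrib, h', sub_nonneg] at h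
  refine h.trans_eq ?_
  rw [Finset.mul_sum]
  refine Finset.sum_congr rfl fun i _ => ?_
  have e : ∀ j, (algebraMap ℝ (CStarMatrix n n (K →L[ℂ] K)) (‖N‖ ^ 2)) i j (x j) =
      if i = j then (‖N‖ ^ 2) • x j else 0 := fun j => by
    rw [Algebra.algebraMap_eq_smul_one]
    change (‖N‖ ^ 2) • ((1 : CStarMatrix n n (K →L[ℂ] K)) i j) (x j) = _
    rw [CStarMatrix.one_apply]
    split_ifs <;> simp
  refine (Finset.sum_congr rfl fun j _ => congrArg (fun y => (⟪x i, y⟫_ℂ).re) (e j)).trans ?_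
  rw [Finset.sum_eq_single i (fun j _ hj => by simp [Ne.symm hj]) (by simp)]
  rw [if_pos rfl, inner_smul_right_eq_smul, Complex.smul_re, inner_self_eq_norm_sq_to_K]
  simp [← Complex.ofReal_pow]

end MatrixVectors

/-- An accretive element `m` of a C*-algebra satisfies `‖1 - t m‖² ≤ 1 + t² ‖m‖²`. -/
lemma norm_one_sub_smul_sq_le {B : Type*} [CStarAlgebra B] [PartialOrder B] [StarOrderedRing B]
    {m : B} (hm : 0 ≤ m + star m) {t : ℝ} (ht : 0 ≤ t) :
    ‖1 - (t : ℂ) • m‖ ^ 2 ≤ 1 + t ^ 2 * ‖m‖ ^ 2 := by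
  rw [Complex.coe_smul]
  have e : algebraMap ℝ B (1 + t ^ 2 * ‖m‖ ^ 2) - star (1 - t • m) * (1 - t • m) =
      t • (m + star m) + (t ^ 2) • (algebraMap ℝ B (‖m‖ ^ 2) - star m * m) := by
    simp only [star_sub, star_one, star_smul, star_trivial, map_add, map_one,
      map_mul, sub_mul, mul_sub, one_mul, mul_one, smul_mul_smul_comm, smul_sub, smul_add,
      Algebra.algebraMap_eq_smul_one, smul_smul, sq]
    abel
  have h : star (1 - t • m) * (1 - t • m) ≤ algebraMap ℝ B (1 + t ^ 2 * ‖m‖ ^ 2) := by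
    rw [← sub_nonneg, e]
    exact add_nonneg (smul_nonneg ht hm) (smul_nonneg (by positivity)
      (sub_nonneg.2 CStarAlgebra.star_mul_le_algebraMap_norm_sq))
  have := (CStarAlgebra.norm_le_iff_le_algebraMap _ (by positivity) (star_mul_self_nonneg _)).2 h
  rwa [CStarRing.norm_star_mul_self, ← sq] at this

variable {B : Type u} [CStarAlgebra B] [PartialOrder B] [StarOrderedRing B]
  {K : Type v} [NormedAddCommGroup K] [InnerProductSpace ℂ K] [CompleteSpace K]
  {A : Subalgebra ℂ B} {φ : A →ₗ[ℂ] (K →L[ℂ] K)}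

/-- Frees the index type from `Fin n`; the arrow matrices below are indexed by `Option ι`. -/
lemma IsUCC.norm_map_le (hφ : IsUCC A φ) {n : Type*} [Fintype n] [DecidableEq n]
    (M : CStarMatrix n n A) : ‖M.map φ‖ ≤ ‖M.map ((↑) : A → B)‖ := by
  let e := Fintype.equivFin n
  have h := hφ.2 _ (CStarMatrix.reindexₗ ℂ A e e M)
  have h1 : (CStarMatrix.reindexₗ ℂ A e e M).map φ =
      CStarMatrix.reindexₐ ℂ (K →L[ℂ] K) e (M.map φ) := rfl
  have h2 : (CStarMatrix.reindexₗ ℂ A e e M).map ((↑) : A → B) =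
      CStarMatrix.reindexₐ ℂ B e (M.map ((↑) : A → B)) := rfl
  rwa [h1, h2, NonUnitalStarAlgHom.norm_map _ (EquivLike.injective _),
    NonUnitalStarAlgHom.norm_map _ (EquivLike.injective _)] at h

lemma IsUCC.norm_apply_le (hφ : IsUCC A φ) (a : A) : ‖φ a‖ ≤ ‖(a : B)‖ := by
  have h := hφ.norm_map_le (n := Unit) (CStarMatrix.ofMatrix fun _ _ => a)
  have h1 : (CStarMatrix.ofMatrix fun _ _ => a : CStarMatrix Unit Unit A).map φ =
    CStarMatrix.toOneByOne Unit ℂ (K →L[ℂ] K) (φ a) := rfl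
  have h2 : (CStarMatrix.ofMatrix fun _ _ => a : CStarMatrix Unit Unit A).map ((↑) : A → B) =
    CStarMatrix.toOneByOne Unit ℂ B a := rfl
  rwa [h1, h2, NonUnitalStarAlgHom.norm_map _ (EquivLike.injective _),
    NonUnitalStarAlgHom.norm_map _ (EquivLike.injective _)] at h

open scoped InnerProductSpace

/-- A unital completely contractive map is completely accretive. -/
lemma IsUCC.sum_re_inner_nonneg (hφ : IsUCC A φ) {n : Type*} [Fintype n] [DecidableEq n]
    (M : CStarMatrix n n A)
    (hM : 0 ≤ M.map ((↑) : A → B) + star (M.map ((↑) : A → B))) (x : n → K) :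
    0 ≤ ∑ i, (⟪x i, ∑ j, φ (M i j) (x j)⟫_ℂ).re := by
  set m : CStarMatrix n n B := M.map ((↑) : A → B) with hm
  set R := ∑ i, (⟪x i, ∑ j, φ (M i j) (x j)⟫_ℂ).re with hR
  set X := ∑ j, ‖x j‖ ^ 2
  -- The contraction bound for `1 - t M` gives `‖x - t φ(M) x‖² ≤ (1 + t² ‖m‖²) ‖x‖²`. The terms of
  -- order `0` cancel; after division by `t`, the limit `t → 0` isolates `R`.
  have key : ∀ t : ℝ, 0 < t → 2 * R + t * (‖m‖ ^ 2 * X) ≥ 0 := fun t ht => by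
    have h1 := hφ.norm_map_le (1 - (t : ℂ) • M)
    have e1 : (1 - (t : ℂ) • M).map ((↑) : A → B) = 1 - (t : ℂ) • m := by
      ext i j
      simp only [CStarMatrix.map_apply, CStarMatrix.sub_apply, CStarMatrix.smul_apply, hm,
        CStarMatrix.one_apply]
      split_ifs <;> simp
    rw [e1] at h1
    have h2 := sum_norm_sq_apply_le ((1 - (t : ℂ) • M).map φ) x
    have e2 : ∀ i, ∑ j, (1 - (t : ℂ) • M).map φ i j (x j) =
        x i - (t : ℂ) • ∑ j, φ (M i j) (x j) := fun i => by
      have : ∀ j, (1 - (t : ℂ) • M).map φ i j (x j) =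
          (if i = j then x j else 0) - (t : ℂ) • φ (M i j) (x j) := fun j => by
        simp only [CStarMatrix.map_apply, CStarMatrix.sub_apply, CStarMatrix.smul_apply,
          CStarMatrix.one_apply, map_sub, map_smul, sub_apply, smul_apply]
        split_ifs <;> simp [hφ.1]
      simp only [this, Finset.sum_sub_distrib, Finset.sum_ite_eq, Finset.mem_univ, if_true,
        Finset.smul_sum]
    simp only [e2] at h2
    have h3 : ∀ i, ‖x i‖ ^ 2 - 2 * t * (⟪x i, ∑ j, φ (M i j) (x j)⟫_ℂ).re ≤
        ‖x i - (t : ℂ) • ∑ j, φ (M i j) (x j)‖ ^ 2 := fun i => by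
      have := norm_sub_sq (𝕜 := ℂ) (x i) ((t : ℂ) • ∑ j, φ (M i j) (x j))
      rw [this, inner_smul_right]
      simp only [RCLike.re_eq_complex_re, Complex.re_ofReal_mul]
      nlinarith [sq_nonneg ‖(t : ℂ) • ∑ j, φ (M i j) (x j)‖]
    have h4 := Finset.sum_le_sum fun i (_ : i ∈ Finset.univ) => h3 i
    rw [Finset.sum_sub_distrib, ← Finset.mul_sum] at h4
    have h5 : ‖(1 - (t : ℂ) • M).map φ‖ ^ 2 ≤ 1 + t ^ 2 * ‖m‖ ^ 2 :=
      (pow_le_pow_left₀ (norm_nonneg _) h1 2).trans (norm_one_sub_smul_sq_le hM ht.le)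
    have h6 : X - 2 * t * R ≤ (1 + t ^ 2 * ‖m‖ ^ 2) * X :=
      (h4.trans h2).trans (mul_le_mul_of_nonneg_right h5 (by positivity))
    have h7 : 0 ≤ t * (2 * R + t * (‖m‖ ^ 2 * X)) := by nlinarith
    exact nonneg_of_mul_nonneg_right h7 ht
  have lim : Filter.Tendsto (fun t : ℝ => 2 * R + t * (‖m‖ ^ 2 * X)) (nhdsWithin 0 (Set.Ioi 0))
      (nhds (2 * R)) := by
    have : Filter.Tendsto (fun t : ℝ => 2 * R + t * (‖m‖ ^ 2 * X)) (nhds 0)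
      (nhds (2 * R + 0 * (‖m‖ ^ 2 * X))) := Continuous.tendsto (by fun_prop) 0
    simpa using this.mono_left nhdsWithin_le_nhds
  have := ge_of_tendsto lim (Filter.eventually_of_mem self_mem_nhdsWithin fun t ht => key t ht)
  linarith

end OpAlg

/-! ### A Schwarz inequality for unital completely contractive maps -/

namespace OpAlg

lemma exists_cstarMatrix_option {ι R : Type*} (a : R) (r c : ι → R) (d : ι → ι → R) :
    ∃ M : CStarMatrix (Option ι) (Option ι) R, M none none = a ∧ (∀ j, M none (some j) = r j) ∧
      (∀ i, M (some i) none = c i) ∧ ∀ i j, M (some i) (some j) = d i j :=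
  ⟨CStarMatrix.ofMatrix fun i j => i.elim (j.elim a r) fun i => j.elim (c i) (d i),
    rfl, fun _ => rfl, fun _ => rfl, fun _ _ => rfl⟩

variable {B : Type u} [CStarAlgebra B] [PartialOrder B] [StarOrderedRing B]

open scoped InnerProductSpace

/-- An arrow matrix `[c/2, r; a, 1/2]` is accretive if the column `b = a + r*` satisfies
`b* b ≤ c`. -/
lemma accretive_arrow {ι : Type*} [Fintype ι] [DecidableEq ι] {c : B} {a r : ι → B}
    (hc : IsSelfAdjoint c) (h : ∑ i, star (a i + star (r i)) * (a i + star (r i)) ≤ c)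
    {M : CStarMatrix (Option ι) (Option ι) B}
    (h00 : M none none = (2⁻¹ : ℂ) • c) (h01 : ∀ j, M none (some j) = r j)
    (h10 : ∀ i, M (some i) none = a i)
    (h11 : ∀ i j, M (some i) (some j) = if i = j then (2⁻¹ : ℂ) • 1 else 0) :
    0 ≤ M + star M := by
  -- With `b = a + r*` and `y* y = c - b* b`, the sum `M + M*` is `[c, b*; b, 1] = Z* Z` for `Z =
  -- [y, 0; b, 1]`.
  obtain ⟨y, hy⟩ := exists_eq_star_mul_self (sub_nonneg.2 h)
  obtain ⟨Z, z00, z01, z10, z11⟩ := exists_cstarMatrix_option y (fun _ => 0)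
    (fun i => a i + star (r i)) fun i j => if i = j then (1 : B) else 0
  have hZ : M + star M = star Z * Z := by
    have half : (2⁻¹ : ℂ) + 2⁻¹ = 1 := by norm_num
    ext i j
    rw [CStarMatrix.add_apply, CStarMatrix.star_apply, CStarMatrix.mul_apply]
    simp only [CStarMatrix.star_apply, Fintype.sum_option]
    rcases i with _ | i <;> rcases j with _ | j
    · rw [h00, star_smul, hc.star_eq, Complex.star_def, map_inv₀, map_ofNat, ← add_smul,
        half, one_smul, z00, ← hy]
      simp only [z10]
      abel
    · simp [h01, h10, z01, z10, z11, add_comm]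
    · simp [h01, h10, z01, z10, z11, apply_ite (star : B → B)]
    · simp only [h11, z01, z11, star_zero, zero_mul, zero_add]
      by_cases hij : i = j
      · simp [hij, ← add_smul, half]
      · simp [hij, Ne.symm hij]
  rw [hZ]
  exact star_mul_self_nonneg Z

lemma re_inner_self {K : Type*} [NormedAddCommGroup K] [InnerProductSpace ℂ K] (x : K) : (⟪x, x⟫_ℂ).re = ‖x‖ ^ 2 := by
  rw [inner_self_eq_norm_sq_to_K]; simp [← Complex.ofReal_pow]

lemma norm_one_le_one {B : Type*} [CStarAlgebra B] : ‖(1 : B)‖ ≤ 1 := by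
  rcases subsingleton_or_nontrivial B with _ | _
  · simp [Subsingleton.elim (1 : B) 0]
  · exact CStarRing.norm_one.le

variable {A : Subalgebra ℂ B}
  {H : Type v} [NormedAddCommGroup H] [InnerProductSpace ℂ H] [CompleteSpace H]
  {K : Type w} [NormedAddCommGroup K] [InnerProductSpace ℂ K] [CompleteSpace K]
  {φ : A →ₗ[ℂ] (K →L[ℂ] K)}

/-- A Schwarz inequality for the elements `a + r*`, with `a, r ∈ A`. -/
lemma IsUCC.sum_norm_sq_le (hφ : IsUCC A φ) {ι : Type*} [Fintype ι] {c : A} {a r : ι → A}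
    (hc : IsSelfAdjoint (c : B))
    (h : ∑ i, star ((a i : B) + star (r i : B)) * (a i + star (r i : B)) ≤ c) (x : K) :
    ∑ i, ‖φ (a i) x + (φ (r i)).adjoint x‖ ^ 2 ≤ (⟪x, φ c x⟫_ℂ).re := by
  classical
  obtain ⟨M, h00, h01, h10, h11⟩ := exists_cstarMatrix_option ((2⁻¹ : ℂ) • c) r a
    fun i j => if i = j then (2⁻¹ : ℂ) • (1 : A) else 0
  have hM := accretive_arrow (M := M.map ((↑) : A → B)) hc h (by simp [h00]) (by simp [h01])
    (by simp [h10]) (fun i j => by rw [CStarMatrix.map_apply, h11]; split_ifs <;> simp)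
  set y : ι → K := fun i => φ (a i) x + (φ (r i)).adjoint x with hy
  have half : ∀ z : ℂ, ((2⁻¹ : ℂ) * z).re = 2⁻¹ * z.re := fun z => by
    rw [← Complex.re_ofReal_mul]; norm_num
  have e1 : ∀ i j, (⟪y i, φ (if i = j then (2⁻¹ : ℂ) • (1 : A) else 0) (y j)⟫_ℂ).re =
      if i = j then 2⁻¹ * ‖y j‖ ^ 2 else 0 := fun i j => by
    split_ifs with hij
    · rw [hij, map_smul, hφ.1, smul_apply, inner_smul_right, half, one_apply_eq_self, re_inner_self]
    · simp
  -- The vector `(x, -y)` minimizes the form of `[φ(c), y*; y, 1]` over its second coordinate. The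
  -- cross terms contribute `-∑ ‖y i‖²` and the diagonal block half of that with the opposite sign.
  have key := hφ.sum_re_inner_nonneg M hM fun i => i.elim x fun i => -y i
  have e0 : ∀ i, (⟪y i, φ (a i) x⟫_ℂ).re + (⟪x, φ (r i) (y i)⟫_ℂ).re = ‖y i‖ ^ 2 := fun i => by
    rw [← ContinuousLinearMap.adjoint_inner_left (φ (r i)), ← inner_conj_symm _ (y i),
      Complex.conj_re, ← Complex.add_re, ← inner_add_right, re_inner_self]
  simp only [Fintype.sum_option, Option.elim, h00, h01, h10, h11, inner_add_right, inner_sum,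
    map_neg, inner_neg_right, inner_neg_left, Complex.add_re, Complex.re_sum, Complex.neg_re,
    neg_neg, e1, Finset.sum_ite_eq, Finset.mem_univ, if_true, map_smul, smul_apply,
    inner_smul_right, half] at key
  have e2 := Finset.sum_congr rfl fun i (_ : i ∈ Finset.univ) => e0 i
  simp only [Finset.sum_add_distrib, Finset.sum_neg_distrib, ← Finset.mul_sum] at key e2
  linarith

/-- The case of a column with entries `s` and `t k*`. An adjoint `t k*` need not lie in `A`, which
is why the general inequality allows `a + r*`. -/
lemma IsUCC.sum_norm_sq_add_le (hφ : IsUCC A φ) {κ : Type*} [Fintype κ] {c s : A} {t : κ → A}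
    (hc : IsSelfAdjoint (c : B))
    (h : star (s : B) * s + ∑ k, (t k : B) * star (t k : B) ≤ c) (x : K) :
    ‖φ s x‖ ^ 2 + ∑ k, ‖(φ (t k)).adjoint x‖ ^ 2 ≤ (⟪x, φ c x⟫_ℂ).re := by
  have := hφ.sum_norm_sq_le (a := fun i : Option κ => i.elim s fun _ => 0)
    (r := fun i : Option κ => i.elim 0 t) hc (by simpa [Fintype.sum_option] using h) x
  simpa [Fintype.sum_option] using this

lemma IsUCC.of_starAlgHom (ρ : B →⋆ₐ[ℂ] (K →L[ℂ] K)) : IsUCC A (restrictRep A ρ) :=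
  ⟨map_one ρ, fun n M => NonUnitalStarAlgHom.norm_apply_le
    (CStarMatrix.mapₙₐ (n := Fin n) (ρ : B →⋆ₙₐ[ℂ] (K →L[ℂ] K))) (M.map ((↑) : A → B))⟩

/-! ### Compressions by isometries -/

section Isometry

variable (V : H →ₗᵢ[ℂ] K)

lemma adjoint_isometry_apply (x : H) : V.toContinuousLinearMap.adjoint (V x) = x :=
  ext_inner_left ℂ fun y => by
    rw [ContinuousLinearMap.adjoint_inner_right]
    exact V.inner_map_map y x

/-- Conjugation `T ↦ V T V*` by an isometry. -/
noncomputable def conjIsometry : (H →L[ℂ] H) →⋆ₙₐ[ℂ] (K →L[ℂ] K) where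
  toFun T := V.toContinuousLinearMap ∘L T ∘L V.toContinuousLinearMap.adjoint
  map_smul' c T := by ext; simp
  map_zero' := by ext; simp
  map_add' S T := by ext; simp
  map_mul' S T := by ext x; simp [adjoint_isometry_apply]
  map_star' T := by
    simp [ContinuousLinearMap.star_eq_adjoint, ContinuousLinearMap.adjoint_comp,
      ContinuousLinearMap.comp_assoc]

lemma conjIsometry_apply (T : H →L[ℂ] H) (x : K) :
    conjIsometry V T x = V (T (V.toContinuousLinearMap.adjoint x)) := rfl

lemma conjIsometry_injective : Function.Injective (conjIsometry V) := fun S T h => by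
  ext x
  have := DFunLike.congr_fun h (V x)
  rwa [conjIsometry_apply, conjIsometry_apply, adjoint_isometry_apply, V.injective.eq_iff] at this

/-- The compression `T ↦ V* T V` by an isometry. -/
noncomputable def compression : (K →L[ℂ] K) →ₗ[ℂ] (H →L[ℂ] H) where
  toFun T := V.toContinuousLinearMap.adjoint ∘L T ∘L V.toContinuousLinearMap
  map_smul' c T := by ext; simp
  map_add' S T := by ext; simp

lemma compression_apply (T : K →L[ℂ] K) (x : H) :
    compression V T x = V.toContinuousLinearMap.adjoint (T (V x)) := rfl

/-- Conjugation by `V` is an injective, hence isometric, *-homomorphism on matrices. It turns the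
compressed matrix into `F 1 * M * F 1`, where `F 1` is the diagonal matrix of `V V*`. -/
lemma norm_map_compression_le {n : Type*} [Fintype n] [DecidableEq n]
    (M : CStarMatrix n n (K →L[ℂ] K)) : ‖M.map (compression V)‖ ≤ ‖M‖ := by
  let F : CStarMatrix n n (H →L[ℂ] H) →⋆ₙₐ[ℂ] CStarMatrix n n (K →L[ℂ] K) :=
    CStarMatrix.mapₙₐ (conjIsometry V)
  have hF : Function.Injective F := CStarMatrix.map_injective (conjIsometry_injective V)
  have e : F (M.map (compression V)) = F 1 * M * F 1 := by
    have h1 : ∀ i j, (F 1) i j = if i = j then conjIsometry V 1 else 0 := fun i j => by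
      change conjIsometry V ((1 : CStarMatrix n n (H →L[ℂ] H)) i j) = _
      rw [CStarMatrix.one_apply]
      split_ifs <;> simp
    ext i j x
    rw [CStarMatrix.mul_apply]
    simp only [CStarMatrix.mul_apply, h1, ite_mul, mul_ite, zero_mul, mul_zero, Finset.sum_ite_eq,
      Finset.sum_ite_eq', Finset.mem_univ, if_true]
    rfl
  have h1 : ‖F 1‖ ≤ 1 := (NonUnitalStarAlgHom.norm_apply_le F 1).trans norm_one_le_one
  rw [← NonUnitalStarAlgHom.norm_map F hF, e]
  calc ‖F 1 * M * F 1‖ ≤ ‖F 1‖ * ‖M‖ * ‖F 1‖ :=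
        (norm_mul_le _ _).trans (by gcongr; exact norm_mul_le _ _)
    _ ≤ 1 * ‖M‖ * 1 := by gcongr
    _ = ‖M‖ := by simp

lemma IsUCC.compression (hφ : IsUCC A φ) : IsUCC A (compression V ∘ₗ φ) := by
  refine ⟨?_, fun n M => (norm_map_compression_le V (M.map φ)).trans (hφ.2 n M)⟩
  ext x
  simp [hφ.1, compression_apply, adjoint_isometry_apply]

end Isometry

end OpAlg

namespace OpAlg

set_option linter.unusedSectionVars false

open scoped InnerProductSpace CStarAlgebra

variable {B : Type u} [CStarAlgebra B] [PartialOrder B] [StarOrderedRing B]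
  {H : Type v} [NormedAddCommGroup H] [InnerProductSpace ℂ H] [CompleteSpace H]

/-! ### The multiplicative domain of a unital completely positive map, vector by vector -/

section Schwarz

lemma sum_re_inner_completelyPositive_nonneg (ψ : B →CP (H →L[ℂ] H)) {n : Type*} [Fintype n]
    [DecidableEq n] (a : n → B) (x : n → H) :
    0 ≤ ∑ i, ∑ j, (⟪x i, ψ (star (a i) * a j) (x j)⟫_ℂ).re := by
  obtain ⟨Z, h00, h01, h10, h11⟩ := exists_cstarMatrix_option (0 : B) a (fun _ => 0) fun _ _ => 0
  have h := sum_re_inner_nonneg (ψ.map_cstarMatrix_nonneg (star Z * Z) (star_mul_self_nonneg Z))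
    fun i => i.elim 0 x
  have e : ∀ i j, (star Z * Z) (some i) (some j) = star (a i) * a j := fun i j => by
    rw [CStarMatrix.mul_apply]
    simp [Fintype.sum_option, CStarMatrix.star_apply, h01, h11]
  simpa [Fintype.sum_option, CStarMatrix.map_apply, e] using h

lemma completelyPositive_map_star (ψ : B →CP (H →L[ℂ] H)) (b : B) : ψ (star b) = star (ψ b) :=
  map_star ψ b

lemma re_inner_nonneg {T : H →L[ℂ] H} (hT : 0 ≤ T) (x : H) : 0 ≤ (⟪x, T x⟫_ℂ).re :=
  ((ContinuousLinearMap.nonneg_iff_isPositive T).1 hT).re_inner_nonneg_right x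

lemma re_inner_mono {S T : H →L[ℂ] H} (h : S ≤ T) (x : H) :
    (⟪x, S x⟫_ℂ).re ≤ (⟪x, T x⟫_ℂ).re := by
  simpa [inner_sub_right] using re_inner_nonneg (sub_nonneg.2 h) x

/-- Positivity of `ψ` on the Gram matrix of `a, 1, b*`, tested on `x, -ψ(a) x, -t d` with `d = ψ(b
a) x - ψ(b) ψ(a) x`. The constant term in `t` is the Schwarz defect of `a` at `x`. If it vanishes,
the linear term forces `d = 0`. -/
lemma schwarz_aux (ψ : B →CP (H →L[ℂ] H)) (h1 : ψ 1 = 1) (a b : B) (x : H) (t : ℝ) :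
    0 ≤ ((⟪x, ψ (star a * a) x⟫_ℂ).re - ‖ψ a x‖ ^ 2) - 2 * t * ‖ψ (b * a) x - ψ b (ψ a x)‖ ^ 2 +
      t ^ 2 * (⟪ψ (b * a) x - ψ b (ψ a x),
        ψ (b * star b) (ψ (b * a) x - ψ b (ψ a x))⟫_ℂ).re := by
  set d := ψ (b * a) x - ψ b (ψ a x) with hd
  have key := sum_re_inner_completelyPositive_nonneg ψ ![a, 1, star b] ![x, -ψ a x, (-t : ℂ) • d]
  have e1 : ψ (star a) = (ψ a).adjoint := completelyPositive_map_star ψ a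
  have e2 : ψ (star b) = (ψ b).adjoint := completelyPositive_map_star ψ b
  have e3 : ψ (star a * star b) = (ψ (b * a)).adjoint := by
    rw [← star_mul]; exact completelyPositive_map_star ψ _
  have e4 : (⟪d, ψ (b * a) x⟫_ℂ).re - (⟪d, ψ b (ψ a x)⟫_ℂ).re = ‖d‖ ^ 2 := by
    rw [← Complex.sub_re, ← inner_sub_right, ← hd, re_inner_self]
  have e5 : ∀ y z : H, (⟪y, z⟫_ℂ).re = (⟪z, y⟫_ℂ).re := fun y z => by
    rw [← inner_conj_symm, Complex.conj_re]
  simp only [Fin.sum_univ_three, Matrix.cons_val_zero, Matrix.cons_val_one, Matrix.cons_val,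
    star_one, star_star, one_mul, mul_one, h1, e1, e2, e3, inner_neg_left, inner_neg_right,
    map_neg, map_smul, inner_smul_left, inner_smul_right, one_apply_eq_self,
    ContinuousLinearMap.adjoint_inner_right, Complex.neg_re, neg_neg, ← Complex.ofReal_neg,
    Complex.conj_ofReal, Complex.re_ofReal_mul, re_inner_self, e5 _ d] at key
  rw [← e4]
  linarith

lemma norm_sq_apply_le (ψ : B →CP (H →L[ℂ] H)) (h1 : ψ 1 = 1) (a : B) (x : H) :
    ‖ψ a x‖ ^ 2 ≤ (⟪x, ψ (star a * a) x⟫_ℂ).re := by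
  have := schwarz_aux ψ h1 a 0 x 0
  linarith

/-- Equality in the Schwarz inequality implies multiplicativity. -/
lemma map_mul_apply_of_le (ψ : B →CP (H →L[ℂ] H)) (h1 : ψ 1 = 1) {a : B} {x : H}
    (h : (⟪x, ψ (star a * a) x⟫_ℂ).re ≤ ‖ψ a x‖ ^ 2) (b : B) : ψ (b * a) x = ψ b (ψ a x) := by
  set d := ψ (b * a) x - ψ b (ψ a x) with hd
  set r := (⟪d, ψ (b * star b) d⟫_ℂ).re
  have key : ∀ t : ℝ, 0 < t → 2 * ‖d‖ ^ 2 ≤ t * r := fun t ht => by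
    have := schwarz_aux ψ h1 a b x t
    rw [← hd] at this
    have h2 : t * (2 * ‖d‖ ^ 2) ≤ t * (t * r) := by nlinarith
    exact le_of_mul_le_mul_left h2 ht
  have hr : 0 ≤ r := by nlinarith [key 1 one_pos, sq_nonneg ‖d‖]
  have hd0 : ‖d‖ ^ 2 ≤ 0 := by
    -- This `t` makes `t * r ≤ ‖d‖²`, against `2 ‖d‖² ≤ t * r`; the `+ 1` covers `r = 0`.
    have := key (‖d‖ ^ 2 / (r + 1))
    by_contra! hlt
    have h3 := this (by positivity)
    have h4 : ‖d‖ ^ 2 / (r + 1) * r ≤ ‖d‖ ^ 2 := by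
      rw [div_mul_eq_mul_div, div_le_iff₀ (by positivity)]
      nlinarith
    linarith
  exact sub_eq_zero.1 (norm_eq_zero.1 (pow_eq_zero_iff two_ne_zero |>.1 
    (le_antisymm hd0 (by positivity))))

end Schwarz

/-! ### Rigid families: maximality and unique extension -/

variable {A : Subalgebra ℂ B} {ρ : B →⋆ₐ[ℂ] (H →L[ℂ] H)}

/-- A family of rows of elements of `A`, such that each row is a contraction that `ρ` maps to a
coisometry, and such that each entry `s` satisfies `s* s ≤ ε + q + (1 - ∑ t t*)` for some other row
`t` and some `q ∈ A` with `ρ q = ρ (s* s)`. -/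
structure IsRigidFamily (A : Subalgebra ℂ B) (ρ : B →⋆ₐ[ℂ] (H →L[ℂ] H)) {ι κ : Type*} [Fintype κ]
    (s : ι → κ → A) : Prop where
  row_le : ∀ i, ∑ k, (s i k : B) * star (s i k : B) ≤ 1
  map_row : ∀ i, ρ (∑ k, (s i k : B) * star (s i k : B)) = 1
  le_row : ∀ i k, ∀ ε : ℝ, 0 < ε → ∃ i', ∃ q : A, IsSelfAdjoint (q : B) ∧
    star (s i k : B) * s i k + ∑ k', (s i' k' : B) * star (s i' k' : B) ≤
      ((1 + ε : ℝ) : ℂ) • 1 + (q : B) ∧ ρ q = ρ (star (s i k : B) * s i k)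

namespace IsRigidFamily

variable {ι κ : Type*} [Fintype κ] {s : ι → κ → A}

lemma sum_norm_sq (hs : IsRigidFamily A ρ s) (i : ι) (h : H) :
    ∑ k, ‖(ρ (s i k)).adjoint h‖ ^ 2 = ‖h‖ ^ 2 := by
  have := congrArg (fun T : H →L[ℂ] H => (⟪h, T h⟫_ℂ).re) (hs.map_row i)
  simp only [map_sum, map_mul, map_star, sum_apply, mul_apply_eq_comp, inner_sum,
    Complex.re_sum, ContinuousLinearMap.star_eq_adjoint, one_apply_eq_self, re_inner_self] at this
  rw [← this]
  refine Finset.sum_congr rfl fun k _ => ?_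
  rw [← ContinuousLinearMap.adjoint_inner_left, re_inner_self]

lemma re_inner_star_mul_self (ρ : B →⋆ₐ[ℂ] (H →L[ℂ] H)) (b : B) (h : H) :
    (⟪h, ρ (star b * b) h⟫_ℂ).re = ‖ρ b h‖ ^ 2 := by
  rw [map_mul, map_star, ContinuousLinearMap.star_eq_adjoint]
  change (⟪h, (ρ b).adjoint (ρ b h)⟫_ℂ).re = _
  rw [ContinuousLinearMap.adjoint_inner_right, re_inner_self]

section Maximal

variable {K : Type w} [NormedAddCommGroup K] [InnerProductSpace ℂ K] [CompleteSpace K]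
  {φ' : A →ₗ[ℂ] (K →L[ℂ] K)} {V : H →ₗᵢ[ℂ] K}

/-- Here `V g` is the projection of `y` onto the range of `V`, so `‖y - V g‖² = ‖y‖² - ‖g‖²`. -/
lemma eq_of_adjoint_eq {y : K} {g : H} (h : V.toContinuousLinearMap.adjoint y = g)
    (hy : ‖y‖ ^ 2 ≤ ‖g‖ ^ 2) : y = V g := by
  have h1 := norm_sub_sq (𝕜 := ℂ) y (V g)
  have h2 : ⟪y, V g⟫_ℂ = ⟪g, g⟫_ℂ := by
    conv_rhs => rw [← h]
    rw [ContinuousLinearMap.adjoint_inner_left, h]; rfl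
  rw [h2, V.norm_map, RCLike.re_eq_complex_re, re_inner_self] at h1
  exact sub_eq_zero.1 (norm_eq_zero.1 (pow_eq_zero_iff two_ne_zero |>.1
    (le_antisymm (by linarith) (by positivity))))

/-- Termwise `‖ρ(s)* h‖ ≤ ‖φ'(s)* V h‖` since `V*` is a contraction. The row sums satisfy the
opposite inequality, because `φ'` maps a row contraction to one and `ρ` maps it to a coisometry.
Equality holds in each term. -/
lemma adjoint_apply_isometry (hs : IsRigidFamily A ρ s) (hφ' : IsUCC A φ')
    (hV : ∀ a : A, ρ a = compression V (φ' a)) (i : ι) (k : κ) (h : H) :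
    (φ' (s i k)).adjoint (V h) = V ((ρ (s i k)).adjoint h) := by
  have e : ∀ k, V.toContinuousLinearMap.adjoint ((φ' (s i k)).adjoint (V h)) =
      (ρ (s i k)).adjoint h := fun k => by
    refine ext_inner_left ℂ fun y => ?_
    rw [ContinuousLinearMap.adjoint_inner_right, ContinuousLinearMap.adjoint_inner_right,
      ContinuousLinearMap.adjoint_inner_right, hV, compression_apply,
      ContinuousLinearMap.adjoint_inner_left]
    rfl
  have hle : ∀ k ∈ Finset.univ, ‖(ρ (s i k)).adjoint h‖ ^ 2 ≤ ‖(φ' (s i k)).adjoint (V h)‖ ^ 2 :=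
    fun k _ => by
      rw [← e]
      gcongr
      refine (ContinuousLinearMap.le_opNorm _ _).trans (mul_le_of_le_one_left (norm_nonneg _) ?_)
      rw [LinearIsometryEquiv.norm_map]
      exact V.norm_toContinuousLinearMap_le
  have h1 := hφ'.sum_norm_sq_add_le (c := 1) (s := 0) (t := s i) (by simp)
    (by simpa using hs.row_le i) (V h)
  have h2 := (Finset.sum_eq_sum_iff_of_le hle).1 (le_antisymm (Finset.sum_le_sum hle) (by
    rw [hs.sum_norm_sq]
    simpa [hφ'.1, re_inner_self, ← Complex.ofReal_pow] using h1))
  exact eq_of_adjoint_eq (e k) (h2 k (Finset.mem_univ k)).ge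

/-- By the previous lemma the row `t = s i'` already uses up `‖h‖²` in the Schwarz inequality. What
remains bounds `‖φ'(s) V h‖²` by `‖ρ(s) h‖²` up to `ε`. -/
lemma apply_isometry (hs : IsRigidFamily A ρ s) (hφ' : IsUCC A φ')
    (hV : ∀ a : A, ρ a = compression V (φ' a)) (i : ι) (k : κ) (h : H) :
    φ' (s i k) (V h) = V (ρ (s i k) h) := by
  refine eq_of_adjoint_eq (by rw [hV]; rfl) (le_of_forall_pos_le_add fun ε hε => ?_)
  -- The tolerance is scaled so that the final error, tolerance times `‖h‖²`, is at most `ε`; the `+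
  -- 1` covers `h = 0`.
  obtain ⟨i', q, hq, hle, hρ⟩ := hs.le_row i k (ε / (‖h‖ ^ 2 + 1)) (by positivity)
  have h1 := hφ'.sum_norm_sq_add_le (c := ((1 + ε / (‖h‖ ^ 2 + 1) : ℝ) : ℂ) • 1 + q) (s := s i k)
    (t := s i') (by
      refine IsSelfAdjoint.add ?_ hq
      simp [IsSelfAdjoint, star_smul]) hle (V h)
  simp only [hs.adjoint_apply_isometry hφ' hV, V.norm_map, hs.sum_norm_sq] at h1
  have h2 : (⟪V h, φ' q (V h)⟫_ℂ).re = ‖ρ (s i k) h‖ ^ 2 := by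
    rw [← re_inner_star_mul_self, ← hρ, hV, compression_apply,
      ContinuousLinearMap.adjoint_inner_right]
    rfl
  rw [map_add, map_smul, hφ'.1, add_apply, inner_add_right, Complex.add_re, h2, smul_apply,
    inner_smul_right, Complex.re_ofReal_mul, one_apply_eq_self, re_inner_self, V.norm_map] at h1
  have h3 : ε / (‖h‖ ^ 2 + 1) * ‖h‖ ^ 2 ≤ ε := by
    rw [div_mul_eq_mul_div, div_le_iff₀ (by positivity)]
    nlinarith
  linarith

lemma apply_isometry_of_dense (hs : IsRigidFamily A ρ s)
    (hA : Dense (Submodule.span ℂ (Set.range fun p : ι × κ => s p.1 p.2) : Set A))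
    (hφ' : IsUCC A φ') (hV : ∀ a : A, ρ a = compression V (φ' a)) (a : A) (h : H) :
    φ' a (V h) = V (ρ a h) := by
  let f : A →L[ℂ] (K →L[ℂ] K) := φ'.mkContinuous 1 fun a => by
    rw [one_mul]; exact hφ'.norm_apply_le a
  let g : A →L[ℂ] (H →L[ℂ] H) := (restrictRep A ρ).mkContinuous 1 fun a => by
    rw [one_mul]; exact (IsUCC.of_starAlgHom (A := A) ρ).norm_apply_le a
  have e : (ContinuousLinearMap.apply ℂ K (V h)).comp f =
      V.toContinuousLinearMap.comp ((ContinuousLinearMap.apply ℂ H h).comp g) := by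
    refine ContinuousLinearMap.ext_on hA ?_
    rintro _ ⟨p, rfl⟩
    exact hs.apply_isometry hφ' hV p.1 p.2 h
  exact DFunLike.congr_fun e a

/-- The other half of reduction: it makes `(V H)ᗮ` invariant under `φ'`. It is stated with `V*` on
the left so that both sides are linear and continuous in `a`. -/
lemma adjoint_isometry_apply_of_dense (hs : IsRigidFamily A ρ s)
    (hA : Dense (Submodule.span ℂ (Set.range fun p : ι × κ => s p.1 p.2) : Set A))
    (hφ' : IsUCC A φ') (hV : ∀ a : A, ρ a = compression V (φ' a)) (a : A) (x : K) :
    V.toContinuousLinearMap.adjoint (φ' a x) = ρ a (V.toContinuousLinearMap.adjoint x) := by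
  let f : A →L[ℂ] (K →L[ℂ] K) := φ'.mkContinuous 1 fun a => by
    rw [one_mul]; exact hφ'.norm_apply_le a
  let g : A →L[ℂ] (H →L[ℂ] H) := (restrictRep A ρ).mkContinuous 1 fun a => by
    rw [one_mul]; exact (IsUCC.of_starAlgHom (A := A) ρ).norm_apply_le a
  have e : V.toContinuousLinearMap.adjoint.comp ((ContinuousLinearMap.apply ℂ K x).comp f) =
      (ContinuousLinearMap.apply ℂ H (V.toContinuousLinearMap.adjoint x)).comp g := by
    refine ContinuousLinearMap.ext_on hA ?_
    rintro _ ⟨p, rfl⟩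
    refine ext_inner_left ℂ fun y => ?_
    change ⟪y, V.toContinuousLinearMap.adjoint (φ' (s p.1 p.2) x)⟫_ℂ =
      ⟪y, ρ (s p.1 p.2) (V.toContinuousLinearMap.adjoint x)⟫_ℂ
    rw [ContinuousLinearMap.adjoint_inner_right, ← ContinuousLinearMap.adjoint_inner_left (φ' _),
      ← ContinuousLinearMap.adjoint_inner_left (ρ _), ContinuousLinearMap.adjoint_inner_right]
    exact congrArg (fun z => ⟪z, x⟫_ℂ) (hs.adjoint_apply_isometry hφ' hV p.1 p.2 y)
  exact DFunLike.congr_fun e a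

end Maximal

theorem isMaximal (hs : IsRigidFamily A ρ s)
    (hA : Dense (Submodule.span ℂ (Set.range fun p : ι × κ => s p.1 p.2) : Set A)) :
    IsMaximal.{u, v, w} A (restrictRep A ρ) := by
  refine ⟨.of_starAlgHom ρ, fun K _ _ _ V φ' hφ' hV => ?_⟩
  let W : V.toLinearMap.rangeᗮ →ₗᵢ[ℂ] K := V.toLinearMap.rangeᗮ.subtypeₗᵢ
  refine ⟨compression W ∘ₗ φ', hφ'.compression W, fun a h l => ?_⟩
  rw [map_add, hs.apply_isometry_of_dense hA hφ' hV]
  have hl : V.toContinuousLinearMap.adjoint (l : K) = 0 := ext_inner_left ℂ fun y => by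
    rw [ContinuousLinearMap.adjoint_inner_right, inner_zero_right]
    exact (Submodule.mem_orthogonal _ _).1 l.2 _ ⟨y, rfl⟩
  have hm : φ' a l ∈ V.toLinearMap.rangeᗮ := by
    rw [Submodule.mem_orthogonal]
    rintro _ ⟨y, rfl⟩
    change ⟪V.toContinuousLinearMap y, _⟫_ℂ = 0
    rw [← ContinuousLinearMap.adjoint_inner_right, hs.adjoint_isometry_apply_of_dense hA hφ' hV,
      hl, map_zero, inner_zero_right]
  congr 1
  have := adjoint_isometry_apply W ⟨φ' a l, hm⟩
  exact congrArg Subtype.val this.symm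

section UniqueExtension

variable {ψ : B →CP (H →L[ℂ] H)}

/-- The Schwarz inequality for the adjoints in the row `s i'` gives `⟪h, ψ(∑ t t*) h⟫ ≥ ‖h‖²`.
Applying `ψ` to `le_row` then leaves no Schwarz defect at `s i k`. -/
lemma map_mul_entry (hs : IsRigidFamily A ρ s) (h1 : ψ 1 = 1) (hψ : ∀ a : A, ψ a = ρ a)
    (i : ι) (k : κ) (b : B) : ψ (b * s i k) = ψ b * ρ (s i k) := by
  ext h
  refine (map_mul_apply_of_le ψ h1 (le_of_forall_pos_le_add fun ε hε => ?_) b).trans (by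
    rw [hψ]; rfl)
  obtain ⟨i', q, hq, hle, hρ⟩ := hs.le_row i k (ε / (‖h‖ ^ 2 + 1)) (by positivity)
  have h2 := re_inner_mono (OrderHomClass.mono ψ hle) h
  have h3 : ‖h‖ ^ 2 ≤ (⟪h, ψ (∑ k', (s i' k' : B) * star (s i' k' : B)) h⟫_ℂ).re := by
    rw [← hs.sum_norm_sq i', map_sum, sum_apply, inner_sum, Complex.re_sum]
    refine Finset.sum_le_sum fun k' _ => ?_
    have h4 := norm_sq_apply_le ψ h1 (star (s i' k' : B)) h
    rwa [star_star, completelyPositive_map_star, hψ] at h4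
  rw [map_add, map_add, map_smul, h1, hψ, hρ, add_apply, add_apply, inner_add_right,
    inner_add_right, Complex.add_re, Complex.add_re, re_inner_star_mul_self, smul_apply,
    inner_smul_right, Complex.re_ofReal_mul, one_apply_eq_self, re_inner_self] at h2
  have h4 : ε / (‖h‖ ^ 2 + 1) * ‖h‖ ^ 2 ≤ ε := by
    rw [div_mul_eq_mul_div, div_le_iff₀ (by positivity)]
    nlinarith
  rw [hψ]
  linarith

/-- The Schwarz lower bounds for the entries of the row add up to `‖h‖²`, and `row_le` is the
matching upper bound. So each of them is an equality. -/
lemma map_mul_star_entry (hs : IsRigidFamily A ρ s) (h1 : ψ 1 = 1) (hψ : ∀ a : A, ψ a = ρ a)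
    (i : ι) (k : κ) (b : B) : ψ (b * star (s i k : B)) = ψ b * star (ρ (s i k)) := by
  have hst : ∀ k, ψ (star (s i k : B)) = (ρ (s i k)).adjoint := fun k => by
    rw [completelyPositive_map_star, hψ]; rfl
  ext h
  have hle : ∀ k ∈ Finset.univ, ‖(ρ (s i k)).adjoint h‖ ^ 2 ≤
      (⟪h, ψ ((s i k : B) * star (s i k : B)) h⟫_ℂ).re := fun k _ => by
    have h4 := norm_sq_apply_le ψ h1 (star (s i k : B)) h
    rwa [star_star, hst] at h4
  have h2 := re_inner_mono (OrderHomClass.mono ψ (hs.row_le i)) h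
  rw [h1, one_apply_eq_self, re_inner_self, map_sum, sum_apply, inner_sum, Complex.re_sum,
    ← hs.sum_norm_sq i] at h2
  have h3 := (Finset.sum_eq_sum_iff_of_le hle).1 (le_antisymm (Finset.sum_le_sum hle) h2) k
    (Finset.mem_univ k)
  refine (map_mul_apply_of_le ψ h1 (a := star (s i k : B)) (by rw [star_star, hst, h3]) b).trans ?_
  rw [hst]; rfl

lemma eq_of_forall_eq (hs : IsRigidFamily A ρ s)
    (hB : Dense (StarAlgebra.adjoin ℂ (Set.range fun p : ι × κ => (s p.1 p.2 : B)) : Set B))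
    (h1 : ψ 1 = 1) (hψ : ∀ a : A, ψ a = ρ a) (b : B) : ψ b = ρ b := by
  have hc : Continuous ψ := map_continuous ψ
  have hcρ : Continuous ρ := map_continuous ρ
  -- An arbitrary left factor `c` is carried along so that the property passes to products.
  have key : ∀ b ∈ StarAlgebra.adjoin ℂ (Set.range fun p : ι × κ => (s p.1 p.2 : B)),
      ∀ c, ψ (c * b) = ψ c * ρ b := fun b hb => by
    rw [← StarSubalgebra.mem_toSubalgebra, StarAlgebra.adjoin_toSubalgebra] at hb
    induction hb using Algebra.adjoin_induction with
    | mem x hx =>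
      rcases hx with ⟨p, rfl⟩ | ⟨p, hp⟩
      · exact hs.map_mul_entry h1 hψ p.1 p.2
      · obtain rfl : star (s p.1 p.2 : B) = x := (congrArg star hp).trans (star_star x)
        intro c
        rw [hs.map_mul_star_entry h1 hψ, map_star]
    | algebraMap r => intro c; simp [Algebra.algebraMap_eq_smul_one]
    | add x y _ _ hx hy => intro c; rw [mul_add, map_add, map_add, hx, hy, mul_add]
    | mul x y _ _ hx hy => intro c; rw [← mul_assoc, hy, hx, map_mul, mul_assoc]
  have e : Set.EqOn ψ ρ
      (StarAlgebra.adjoin ℂ (Set.range fun p : ι × κ => (s p.1 p.2 : B)) : Set B) := fun b hb => by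
    simpa [h1] using key b hb 1
  exact congrFun (hc.ext_on hB hcρ e) b

theorem hasUEP (hs : IsRigidFamily A ρ s)
    (hB : Dense (StarAlgebra.adjoin ℂ (Set.range fun p : ι × κ => (s p.1 p.2 : B)) : Set B)) :
    HasUEP A (restrictRep A ρ) :=
  ⟨.of_starAlgHom ρ, ρ, fun _ => rfl, fun _ h1 hψ => hs.eq_of_forall_eq hB h1 hψ⟩

end UniqueExtension

end IsRigidFamily

end OpAlg

/-! ### Asymptotics of the powers of an irreducible stochastic matrix -/

namespace StochMatrix

open Filter Topology

set_option linter.unusedSectionVars false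

section Averaging

/-- Iterated averaging with weights bounded below converges to a constant. -/
lemma exists_tendsto_of_averaging {Ω : Type*} {C : Finset Ω} (hC : C.Nonempty) {T : Ω → Ω → ℝ}
    {δ c : ℝ} (hδ : 0 < δ) (hT : ∀ i ∈ C, ∀ j ∈ C, δ ≤ T i j) (hT1 : ∀ i ∈ C, ∑ j ∈ C, T i j = 1)
    {f : ℕ → Ω → ℝ} (hf : ∀ q, ∀ i ∈ C, f (q + 1) i = ∑ j ∈ C, T i j * f q j)
    (hc : ∀ i ∈ C, c ≤ f 0 i) :
    ∃ l, c ≤ l ∧ ∀ i ∈ C, Tendsto (fun q => f q i) atTop (𝓝 l) := by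
  set lo : ℕ → ℝ := fun q => C.inf' hC (f q)
  set hi : ℕ → ℝ := fun q => C.sup' hC (f q)
  have hlo : ∀ q, ∀ i ∈ C, lo q ≤ f q i := fun q i h => Finset.inf'_le _ h
  have hhi : ∀ q, ∀ i ∈ C, f q i ≤ hi q := fun q i h => Finset.le_sup' _ h
  have hT0 : ∀ i ∈ C, ∀ j ∈ C, 0 ≤ T i j := fun i hi j hj => hδ.le.trans (hT i hi j hj)
  have h1 : ∀ q, ∀ i ∈ C, lo q ≤ f (q + 1) i := fun q i h => by
    rw [hf q i h, ← one_mul (lo q), ← hT1 i h, Finset.sum_mul]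
    exact Finset.sum_le_sum fun j hj => mul_le_mul_of_nonneg_left (hlo q j hj) (hT0 i h j hj)
  -- The index `j0` of the minimum carries weight at least `δ` in every average. This pulls the
  -- maximum down by `δ` times the oscillation, which therefore shrinks by the factor `1 - δ`.
  have h2 : ∀ q, ∀ i ∈ C, f (q + 1) i ≤ hi q - δ * (hi q - lo q) := fun q i h => by
    obtain ⟨j0, hj0, e0⟩ := Finset.exists_mem_eq_inf' hC (f q)
    have e : hi q - f (q + 1) i = ∑ j ∈ C, T i j * (hi q - f q j) := by
      simp only [mul_sub, Finset.sum_sub_distrib, ← Finset.sum_mul, hT1 i h, one_mul, hf q i h]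
    have h3 : T i j0 * (hi q - f q j0) ≤ ∑ j ∈ C, T i j * (hi q - f q j) :=
      Finset.single_le_sum (f := fun j => T i j * (hi q - f q j))
        (fun j hj => mul_nonneg (hT0 i h j hj) (sub_nonneg.2 (hhi q j hj))) hj0
    have h4 : δ * (hi q - f q j0) ≤ T i j0 * (hi q - f q j0) :=
      mul_le_mul_of_nonneg_right (hT i h j0 hj0) (sub_nonneg.2 (hhi q j0 hj0))
    have e1 : lo q = f q j0 := e0
    rw [e1]
    linarith
  have hlh : ∀ q, lo q ≤ hi q := fun q => by
    obtain ⟨i, h⟩ := hC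
    exact (hlo q i h).trans (hhi q i h)
  have hlo1 : ∀ q, lo q ≤ lo (q + 1) := fun q => Finset.le_inf' _ _ (h1 q)
  have hhi1 : ∀ q, hi (q + 1) ≤ hi q - δ * (hi q - lo q) := fun q => Finset.sup'_le _ _ (h2 q)
  have hhi2 : ∀ q, hi (q + 1) ≤ hi q := fun q =>
    (hhi1 q).trans (sub_le_self _ (mul_nonneg hδ.le (sub_nonneg.2 (hlh q))))
  have hδ1 : δ ≤ 1 := by
    obtain ⟨i, h⟩ := hC
    rw [← hT1 i h]
    exact (hT i h i h).trans (Finset.single_le_sum (f := T i) (hT0 i h) h)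
  have osc : ∀ q, hi q - lo q ≤ (1 - δ) ^ q * (hi 0 - lo 0) := fun q => by
    induction q with
    | zero => simp
    | succ q ih =>
      calc hi (q + 1) - lo (q + 1) ≤ (1 - δ) * (hi q - lo q) := by
            linarith [hhi1 q, hlo1 q]
        _ ≤ (1 - δ) * ((1 - δ) ^ q * (hi 0 - lo 0)) :=
            mul_le_mul_of_nonneg_left ih (by linarith)
        _ = _ := by ring
  have hmono : Monotone lo := monotone_nat_of_le_succ hlo1
  have hanti : Antitone hi := antitone_nat_of_succ_le hhi2
  have hbdd : BddAbove (Set.range lo) := ⟨hi 0, by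
    rintro _ ⟨q, rfl⟩
    exact (hlh q).trans (hanti (Nat.zero_le q))⟩
  have hlim := tendsto_atTop_ciSup hmono hbdd
  have hδ' : 1 - δ < 1 := by linarith
  have hosc : Tendsto (fun q => (1 - δ) ^ q * (hi 0 - lo 0)) atTop (𝓝 0) := by
    simpa using (tendsto_pow_atTop_nhds_zero_of_lt_one (sub_nonneg.2 hδ1) hδ').mul_const _
  refine ⟨⨆ q, lo q, (Finset.le_inf' hC _ hc).trans (le_ciSup hbdd 0), fun i hiC => ?_⟩
  refine tendsto_of_tendsto_of_tendsto_of_le_of_le hlim (by simpa using hlim.add hosc)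
    (fun q => hlo q i hiC) (fun q => ?_)
  linarith [hhi q i hiC, osc q]

end Averaging

variable {Ω : Type*} [Fintype Ω] [DecidableEq Ω] (P : Matrix.rowStochastic ℝ Ω)

lemma sum_pow_row (n : ℕ) (i : Ω) : ∑ j, (P.1 ^ n) i j = 1 :=
  Matrix.sum_row_of_mem_rowStochastic (pow_mem P.2 n) i

lemma pow_le_one (n : ℕ) (i j : Ω) : (P.1 ^ n) i j ≤ 1 :=
  Matrix.le_one_of_mem_rowStochastic (pow_mem P.2 n)

variable {P}

lemma pow_add_pos_iff {m n : ℕ} {i k : Ω} :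
    0 < (P.1 ^ (m + n)) i k ↔ ∃ j, 0 < (P.1 ^ m) i j ∧ 0 < (P.1 ^ n) j k := by
  rw [pow_add, Matrix.mul_apply, Finset.sum_pos_iff_of_nonneg fun j _ =>
    mul_nonneg (pow_nonneg P m i j) (pow_nonneg P n j k)]
  refine ⟨fun ⟨j, _, h⟩ => ⟨j, ?_⟩, fun ⟨j, h1, h2⟩ => ⟨j, Finset.mem_univ j, mul_pos h1 h2⟩⟩
  exact ⟨pos_of_mul_pos_left h (pow_nonneg P n j k), pos_of_mul_pos_right h (pow_nonneg P m i j)⟩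

lemma pow_add_pos {m n : ℕ} {i j k : Ω} (h1 : 0 < (P.1 ^ m) i j) (h2 : 0 < (P.1 ^ n) j k) :
    0 < (P.1 ^ (m + n)) i k := pow_add_pos_iff.2 ⟨j, h1, h2⟩

lemma pow_mul_pos {r : ℕ} {i : Ω} (h : 0 < (P.1 ^ r) i i) (c : ℕ) : 0 < (P.1 ^ (c * r)) i i := by
  induction c with
  | zero => simp
  | succ c ih => rw [Nat.succ_mul]; exact pow_add_pos ih h

variable (P) in
/-- Some power of `P` has an idempotent support. -/
lemma exists_idempotent_support :
    ∃ L, 0 < L ∧ ∀ i j, 0 < (P.1 ^ (L + L)) i j ↔ 0 < (P.1 ^ L) i j := by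
  let S : ℕ → Set (Ω × Ω) := fun n => {x | 0 < (P.1 ^ n) x.1 x.2}
  have hS : ∀ {a b}, S a = S b → ∀ i j, 0 < (P.1 ^ a) i j ↔ 0 < (P.1 ^ b) i j :=
    fun h i j => Set.ext_iff.1 h (i, j)
  have hadd : ∀ {a b}, S a = S b → ∀ c, S (a + c) = S (b + c) := fun h c => by
    ext x
    simp only [S, Set.mem_ofPred_eq, pow_add_pos_iff, hS h]
  obtain ⟨m, n, hne, heq⟩ := Finite.exists_ne_map_eq_of_infinite S
  wlog hlt : m < n generalizing m n
  · exact this n m hne.symm heq.symm (lt_of_le_of_ne (not_lt.1 hlt) hne.symm)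
  -- There are finitely many supports, so two coincide; from `m` on they repeat with period `n - m`.
  have hper : ∀ c k, m ≤ k → S (k + c * (n - m)) = S k := fun c => by
    induction c with
    | zero => simp
    | succ c ih =>
      intro k hk
      have := hadd heq (k - m + c * (n - m))
      rw [show m + (k - m + c * (n - m)) = k + c * (n - m) by omega,
        show n + (k - m + c * (n - m)) = k + (c + 1) * (n - m) by rw [Nat.succ_mul]; omega] at this
      rw [← this, ih k hk]
  have hm : m ≤ (m + 1) * (n - m) :=
    (Nat.le_succ m).trans (Nat.le_mul_of_pos_right _ (Nat.sub_pos_of_lt hlt))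
  -- A multiple of the period that is at least `m`, so doubling it does not change the support. The
  -- factor `m + 1` rather than `m` keeps it positive when `m = 0`.
  exact ⟨(m + 1) * (n - m), Nat.mul_pos m.succ_pos (Nat.sub_pos_of_lt hlt),
    hS (hper (m + 1) _ hm)⟩

lemma pow_mul_pos_iff {L : ℕ} (hL : ∀ i j, 0 < (P.1 ^ (L + L)) i j ↔ 0 < (P.1 ^ L) i j) (c : ℕ)
    (i j : Ω) : 0 < (P.1 ^ ((c + 1) * L)) i j ↔ 0 < (P.1 ^ L) i j := by
  induction c generalizing i j with
  | zero => simp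
  | succ c ih =>
    rw [Nat.succ_mul, pow_add_pos_iff, ← hL, pow_add_pos_iff]
    simp only [ih]

/-- Along the powers of an irreducible stochastic matrix, the nonzero entries in a column
converge. -/
lemma exists_limit_column (hP : P.1.IsIrreducible) (k : Ω) :
    ∃ l : ℝ, 0 < l ∧ ∀ ε > 0, ∃ M, ∀ N ≥ M, ∀ i, 0 < (P.1 ^ N) i k →
      |(P.1 ^ N) i k - l| ≤ ε := by
  classical
  have hirr := (Matrix.isIrreducible_iff_exists_pow_pos hP.nonneg).1 hP
  obtain ⟨L, hL0, hL⟩ := exists_idempotent_support P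
  -- States reachable from `i` in the same number of steps lie in one cyclic class. Go from `l` back
  -- to `i` in `s` steps, close the loop through `l` `L - 1` times, and end at `l'`: the length is
  -- `L * (s + r)`, a positive multiple of `L`.
  have cyc : ∀ {r : ℕ} {i l l' : Ω}, 0 < (P.1 ^ r) i l → 0 < (P.1 ^ r) i l' →
      0 < (P.1 ^ L) l l' := fun {r i l l'} h h' => by
    obtain ⟨s, hs0, hs⟩ := hirr l i
    have h1 := pow_add_pos (pow_mul_pos (pow_add_pos hs h) (L - 1)) (pow_add_pos hs h')
    rw [← Nat.succ_mul, Nat.succ_eq_add_one, Nat.sub_add_cancel hL0, mul_comm,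
      ← Nat.sub_add_cancel (show 1 ≤ s + r by omega)] at h1
    exact (pow_mul_pos_iff hL _ _ _).1 h1
  have refl : ∀ i, 0 < (P.1 ^ L) i i := fun i => cyc (r := 0) (i := i) (by simp) (by simp)
  have symm : ∀ {i j}, 0 < (P.1 ^ L) i j → 0 < (P.1 ^ L) j i := fun h => cyc h (refl _)
  have trans : ∀ {i j k}, 0 < (P.1 ^ L) i j → 0 < (P.1 ^ L) j k → 0 < (P.1 ^ L) i k :=
    fun h h' => (hL _ _).1 (pow_add_pos h h')
  -- The cyclic class of `k`. No mass of `P ^ L` leaves it, and within it all entries are positive,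
  -- so the averaging lemma applies.
  set C : Finset Ω := Finset.univ.filter fun i => 0 < (P.1 ^ L) i k with hCdef
  have hC : ∀ {i}, i ∈ C ↔ 0 < (P.1 ^ L) i k := by simp [hCdef]
  have hCne : C.Nonempty := ⟨k, hC.2 (refl k)⟩
  have hzero : ∀ i ∈ C, ∀ j, j ∉ C → (P.1 ^ L) i j = 0 := fun i hi j hj =>
    le_antisymm (not_lt.1 fun h => hj (hC.2 (trans (symm h) (hC.1 hi)))) (pow_nonneg P L i j)
  set δ := (C ×ˢ C).inf' (hCne.product hCne) fun x => (P.1 ^ L) x.1 x.2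
  have hδ : 0 < δ := (Finset.lt_inf'_iff _).2 fun x hx => by
    rw [Finset.mem_product] at hx
    exact trans (hC.1 hx.1) (symm (hC.1 hx.2))
  have hδle : ∀ i ∈ C, ∀ j ∈ C, δ ≤ (P.1 ^ L) i j := fun i hi j hj =>
    Finset.inf'_le (fun x : Ω × Ω => (P.1 ^ L) x.1 x.2) (Finset.mk_mem_product hi hj)
  obtain ⟨l, hl, hlim⟩ := exists_tendsto_of_averaging hCne (T := P.1 ^ L) hδ hδle
    (fun i hi => by
      rw [← sum_pow_row P L i]
      exact Finset.sum_subset (Finset.subset_univ C) fun j _ hj => hzero i hi j hj)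
    (f := fun q i => (P.1 ^ ((q + 1) * L)) i k) (fun q i hi => by
      rw [Nat.succ_mul, add_comm, pow_add, Matrix.mul_apply]
      refine (Finset.sum_subset (Finset.subset_univ C) fun j _ hj => ?_).symm
      rw [hzero i hi j hj, zero_mul])
    (c := δ) (fun i hi => by simpa using hδle i hi k (hC.2 (refl k)))
  refine ⟨l, hδ.trans_le hl, fun ε hε => ?_⟩
  have hev : ∀ᶠ q in atTop, ∀ i ∈ C, |(P.1 ^ ((q + 1) * L)) i k - l| ≤ ε :=
    (Filter.eventually_all_finset C).2 fun i hi => by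
      have := (Metric.tendsto_nhds.1 (hlim i hi)) ε hε
      exact this.mono fun q hq => by rw [Real.dist_eq] at hq; exact hq.le
  obtain ⟨Q, hQ⟩ := eventually_atTop.1 hev
  refine ⟨(Q + 1) * L, fun N hN i hi => ?_⟩
  obtain ⟨q, r, hq, rfl⟩ : ∃ q r, Q ≤ q ∧ N = r + (q + 1) * L := by
    have h1 : Q + 1 ≤ N / L := (Nat.le_div_iff_mul_le hL0).2 hN
    refine ⟨N / L - 1, N % L, by omega, ?_⟩
    rw [Nat.sub_add_cancel (by omega), mul_comm, Nat.mod_add_div]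
  obtain ⟨l0, h0, h0'⟩ := pow_add_pos_iff.1 hi
  have hl0 := (pow_mul_pos_iff hL _ _ _).1 h0'
  -- The first `r` steps from `i` land in the class `C`. Thus the entry in row `i` is an average of
  -- entries already close to `l`, even when `i` lies in another cyclic class.
  have hmem : ∀ j, 0 < (P.1 ^ r) i j → j ∈ C := fun j hj => hC.2 (trans (cyc hj h0) hl0)
  have e : (P.1 ^ (r + (q + 1) * L)) i k - l =
      ∑ j, (P.1 ^ r) i j * ((P.1 ^ ((q + 1) * L)) j k - l) := by
    simp only [mul_sub, Finset.sum_sub_distrib, ← Finset.sum_mul, sum_pow_row, one_mul]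
    rw [pow_add, Matrix.mul_apply]
  rw [e]
  refine (Finset.abs_sum_le_sum_abs _ _).trans ?_
  rw [← one_mul ε, ← sum_pow_row P r i, Finset.sum_mul]
  refine Finset.sum_le_sum fun j _ => ?_
  rw [abs_mul, abs_of_nonneg (pow_nonneg P r i j)]
  rcases (pow_nonneg P r i j).eq_or_lt with h | h
  · rw [← h, zero_mul, zero_mul]
  · exact mul_le_mul_of_nonneg_left (hQ q hq j (hmem j h)) h.le

/-- The ratios `P^N j k / P^(n+N) i k` tend to `1` if `P^n i j > 0`. -/
lemma exists_abs_ratio_sub_le (hP : P.1.IsIrreducible) {n : ℕ} {i j : Ω} (hij : 0 < (P.1 ^ n) i j)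
    {ε : ℝ} (hε : 0 < ε) : ∃ M, ∀ N ≥ M, ∀ k, 0 < (P.1 ^ N) j k →
      |(P.1 ^ n) i j * (P.1 ^ N) j k / (P.1 ^ (n + N)) i k - (P.1 ^ n) i j| ≤ ε := by
  have hk : ∀ k, ∃ M, ∀ N ≥ M, 0 < (P.1 ^ N) j k →
      |(P.1 ^ n) i j * (P.1 ^ N) j k / (P.1 ^ (n + N)) i k - (P.1 ^ n) i j| ≤ ε := fun k => by
    obtain ⟨l, hl, h⟩ := exists_limit_column hP k
    -- The bound `l / 2` keeps the denominator above `l / 2`; two errors of `ε * l / 4` make the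
    -- numerator at most `ε * l / 2`.
    obtain ⟨M, hM⟩ := h (min (l / 2) (ε * l / 4)) (by positivity)
    refine ⟨M, fun N hN hjk => ?_⟩
    have hb := pow_add_pos hij hjk
    have h1 := hM N hN j hjk
    have h2 := hM (n + N) (hN.trans (Nat.le_add_left N n)) i hb
    set a := (P.1 ^ N) j k
    set b := (P.1 ^ (n + N)) i k
    have hb2 : l / 2 ≤ b := by
      have := (abs_le.1 (h2.trans (min_le_left _ _))).1
      linarith
    have hab : |a - b| ≤ ε * l / 2 := by
      have h3 := abs_le.1 (h1.trans (min_le_right _ _))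
      have h4 := abs_le.1 (h2.trans (min_le_right _ _))
      rw [abs_le]
      constructor <;> linarith
    have e : (P.1 ^ n) i j * a / b - (P.1 ^ n) i j = (P.1 ^ n) i j * ((a - b) / b) := by
      field_simp
    rw [e, abs_mul, abs_of_pos hij, abs_div, abs_of_pos hb]
    calc _ ≤ 1 * (|a - b| / b) := by gcongr; exact pow_le_one P n i j
      _ ≤ ε := by
        rw [one_mul, div_le_iff₀ hb]
        nlinarith
  choose M hM using hk
  exact ⟨Finset.univ.sup M, fun N hN k => hM k N ((Finset.le_sup (Finset.mem_univ k)).trans hN)⟩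

end StochMatrix

/-! ### The weights of the subproduct maps, and shifts by matrix units -/

namespace StochMatrix

open scoped ComplexOrder

set_option linter.unusedSectionVars false

variable {Ω : Type*} [Fintype Ω] [DecidableEq Ω] {P : Matrix.rowStochastic ℝ Ω}

section Weights

/-- The division hidden in `flat` loses nothing: if `P^(n+m) i l` vanishes, then so does `P^n i k *
P^m k l`. -/
lemma weight_mul_sqrt (n m : ℕ) (i k l : Ω) :
    weight P n m i k l * √((P.1 ^ (n + m)) i l) = √((P.1 ^ n) i k) * √((P.1 ^ m) k l) := by
  have e : weight P n m i k l = (if 0 < √((P.1 ^ (n + m)) i l) then (√((P.1 ^ (n + m)) i l))⁻¹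
    else 0) * (√((P.1 ^ n) i k) * √((P.1 ^ m) k l)) := rfl
  rw [e]
  split_ifs with h
  · field_simp
  · have h0 : (P.1 ^ n) i k * (P.1 ^ m) k l ≤ 0 := by
      by_contra! hlt
      have h1 := pos_of_mul_pos_left hlt (pow_nonneg P m k l)
      have h2 := pos_of_mul_pos_right hlt (pow_nonneg P n i k)
      exact h (Real.sqrt_pos.2 (pow_add_pos h1 h2))
    rw [← Real.sqrt_mul (pow_nonneg P n i k), Real.sqrt_eq_zero'.2 h0]
    simp

/-- The squared weight is the probability that the chain is at `k` at time `n`, given that it starts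
at `i` and is at `l` at time `n + m`. This is the ratio whose limit is needed. -/
lemma weight_sq (n m : ℕ) (i k l : Ω) :
    weight P n m i k l ^ 2 = (P.1 ^ n) i k * (P.1 ^ m) k l / (P.1 ^ (n + m)) i l := by
  have e : weight P n m i k l = (if 0 < √((P.1 ^ (n + m)) i l) then (√((P.1 ^ (n + m)) i l))⁻¹
    else 0) * (√((P.1 ^ n) i k) * √((P.1 ^ m) k l)) := rfl
  rw [e, mul_pow, mul_pow, Real.sq_sqrt (pow_nonneg P n i k), Real.sq_sqrt (pow_nonneg P m k l)]
  split_ifs with h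
  · rw [inv_pow, Real.sq_sqrt (pow_nonneg P (n + m) i l), inv_mul_eq_div]
  · have h0 : (P.1 ^ (n + m)) i l = 0 :=
      le_antisymm (not_lt.1 fun h' => h (Real.sqrt_pos.2 h')) (pow_nonneg P _ i l)
    simp [h0]

lemma weight_assoc (n m r : ℕ) (i k k' l : Ω) :
    weight P n (m + r) i k l * weight P m r k k' l =
      weight P n m i k k' * weight P (n + m) r i k' l := by
  have e1 : weight P n (m + r) i k l = flat (sqrtMat (P.1 ^ (n + m + r))) i l *
      (√((P.1 ^ n) i k) * √((P.1 ^ (m + r)) k l)) := by rw [add_assoc]; rfl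
  have e2 : weight P (n + m) r i k' l = flat (sqrtMat (P.1 ^ (n + m + r))) i l *
      (√((P.1 ^ (n + m)) i k') * √((P.1 ^ r) k' l)) := rfl
  rw [e1, e2]
  linear_combination flat (sqrtMat (P.1 ^ (n + m + r))) i l *
    (√((P.1 ^ n) i k) * weight_mul_sqrt m r k k' l - √((P.1 ^ r) k' l) * weight_mul_sqrt n m i k k')

lemma sum_weight_sq {n m : ℕ} {i l : Ω} (h : 0 < (P.1 ^ (n + m)) i l) :
    ∑ k, weight P n m i k l ^ 2 = 1 := by
  simp only [weight_sq, ← Finset.sum_div]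
  rw [div_eq_one_iff_eq h.ne', pow_add, Matrix.mul_apply]

lemma subprod_assoc (n m r : ℕ) (A B C : Matrix Ω Ω ℂ) :
    subprod P n (m + r) A (subprod P m r B C) = subprod P (n + m) r (subprod P n m A B) C := by
  ext i l
  simp only [subprod_apply, Finset.mul_sum, Finset.sum_mul]
  rw [Finset.sum_comm]
  refine Finset.sum_congr rfl fun k' _ => Finset.sum_congr rfl fun k _ => ?_
  have := congrArg (Complex.ofReal) (weight_assoc (P := P) n m r i k k' l)
  push_cast at this
  linear_combination (A i k * B k k' * C k' l) * this

end Weights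

section Shifts

lemma ext_component {T S : Adjointable (Ω → ℂ) (Fock P)}
    (h : ∀ ξ n, component (T ξ) n = component (S ξ) n) : T = S :=
  DFunLike.ext _ _ fun ξ => component_injective (funext (h ξ))

lemma shift_mul_shift (n m : ℕ) (A B : Matrix Ω Ω ℂ) :
    shift P n A * shift P m B = shift P (n + m) (subprod P n m A B) := by
  refine ext_component fun ξ N => ?_
  rw [Adjointable.mul_apply]
  rcases lt_or_ge N (n + m) with h | h
  · rw [component_shift_of_lt P h]
    rcases lt_or_ge N n with h' | h'
    · rw [component_shift_of_lt P h']
    · obtain ⟨r, rfl⟩ := Nat.exists_eq_add_of_le h'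
      rw [component_shift, component_shift_of_lt P (by omega)]
      ext i l
      simp [subprod_apply]
  · obtain ⟨r, rfl⟩ := Nat.exists_eq_add_of_le h
    rw [component_shift, ← subprod_assoc, add_assoc, component_shift, component_shift]

variable (P) in
/-- The shift operator as a linear function of the matrix. -/
noncomputable def shiftLin (n : ℕ) : Matrix Ω Ω ℂ →ₗ[ℂ] Adjointable (Ω → ℂ) (Fock P) where
  toFun := shift P n
  map_add' A B := ext_component fun ξ N => by
    rw [Adjointable.add_apply, component_add, Pi.add_apply]
    rcases lt_or_ge N n with h | h
    · simp [component_shift_of_lt P h]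
    · obtain ⟨r, rfl⟩ := Nat.exists_eq_add_of_le h
      simp only [component_shift]
      ext i l
      simp [subprod_apply, add_mul, mul_add, Finset.sum_add_distrib]
  map_smul' c A := ext_component fun ξ N => by
    rw [RingHom.id_apply, Adjointable.smul_apply, component_smul, Pi.smul_apply]
    rcases lt_or_ge N n with h | h
    · simp [component_shift_of_lt P h]
    · obtain ⟨r, rfl⟩ := Nat.exists_eq_add_of_le h
      simp only [component_shift]
      ext i l
      simp [subprod_apply, Finset.mul_sum, mul_assoc, mul_left_comm]

lemma shiftLin_apply (n : ℕ) (A : Matrix Ω Ω ℂ) : shiftLin P n A = shift P n A := rfl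

variable (P) in
/-- The shift by a matrix unit. -/
noncomputable def unitShift (n : ℕ) (x : Ω × Ω) : Adjointable (Ω → ℂ) (Fock P) :=
  shift P n (Matrix.single x.1 x.2 1)

lemma shift_eq_sum (n : ℕ) (A : Matrix Ω Ω ℂ) :
    shift P n A = ∑ x : Ω × Ω, A x.1 x.2 • unitShift P n x := by
  conv_lhs => rw [Matrix.matrix_eq_sum_single A, ← shiftLin_apply]
  rw [map_sum, Fintype.sum_prod_type]
  refine Finset.sum_congr rfl fun i _ => ?_
  rw [map_sum]
  refine Finset.sum_congr rfl fun j _ => ?_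
  rw [unitShift, ← shiftLin_apply, ← map_smul, Matrix.smul_single, smul_eq_mul, mul_one]

lemma shift_zero_one : shift P 0 1 = 1 := ext_component fun ξ N => by
  have := component_leftAction (P := P) (fun _ => 1) ξ N
  rw [leftAction, show (Matrix.diagonal fun _ => (1 : ℂ)) = (1 : Matrix Ω Ω ℂ) from
    Matrix.diagonal_one] at this
  rw [this, one_mul, Adjointable.one_apply]

lemma subprod_single (n m : ℕ) (x : Ω × Ω) (B : Matrix Ω Ω ℂ) (a b : Ω) :
    subprod P n m (Matrix.single x.1 x.2 1) B a b =
      if a = x.1 then (weight P n m x.1 x.2 b : ℂ) * B x.2 b else 0 := by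
  rw [subprod_apply]
  by_cases h : a = x.1
  · subst h
    rw [if_pos rfl, Finset.sum_eq_single x.2]
    · simp
    · intro k _ hk; simp [Ne.symm hk]
    · simp
  · rw [if_neg h]
    refine Finset.sum_eq_zero fun k _ => ?_
    simp [Ne.symm h]

lemma subprodAdj_single (n m : ℕ) (x : Ω × Ω) (C : Matrix Ω Ω ℂ) (a b : Ω) :
    subprodAdj P n m (Matrix.single x.1 x.2 1) C a b =
      if a = x.2 then (weight P n m x.1 x.2 b : ℂ) * C x.1 b else 0 := by
  rw [subprodAdj_apply]
  by_cases h : a = x.2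
  · subst h
    rw [if_pos rfl, Finset.sum_eq_single x.1]
    · simp
    · intro k _ hk; simp [Ne.symm hk]
    · simp
  · rw [if_neg h]
    refine Finset.sum_eq_zero fun k _ => ?_
    simp [Ne.symm h]

/-- Lets the rows be indexed by all of `Ω × Ω`, whatever the degree. -/
lemma unitShift_eq_zero {n : ℕ} {x : Ω × Ω} (h : ¬ 0 < (P.1 ^ n) x.1 x.2) :
    unitShift P n x = 0 := ext_component fun ξ N => by
  have h0 : (P.1 ^ n) x.1 x.2 = 0 := le_antisymm (not_lt.1 h) (pow_nonneg P n _ _)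
  rw [Adjointable.zero_apply]
  have hz : component (0 : Fock P) N = 0 := by ext i j; simp [component]
  rw [hz]
  rcases lt_or_ge N n with h | h
  · exact component_shift_of_lt P h _ _
  · obtain ⟨r, rfl⟩ := Nat.exists_eq_add_of_le h
    rw [unitShift, component_shift]
    ext i l
    rw [subprod_single]
    have : weight P n r x.1 x.2 l = 0 := by
      have := weight_sq (P := P) n r x.1 x.2 l
      rw [h0] at this
      simpa using this
    simp [this]

end Shifts

/-! ### Density of the span of the matrix unit shifts -/

section Membership

variable (P)

lemma generators_subset_span : generators P ⊆
    Submodule.span ℂ (Set.range fun p : ℕ × (Ω × Ω) => unitShift P p.1 p.2) := by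
  have h : ∀ n A, shift P n A ∈
      Submodule.span ℂ (Set.range fun p : ℕ × (Ω × Ω) => unitShift P p.1 p.2) := fun n A => by
    rw [shift_eq_sum]
    exact sum_mem fun x _ => Submodule.smul_mem _ _ (Submodule.subset_span ⟨(n, x), rfl⟩)
  rintro T (⟨a, rfl⟩ | ⟨n, A, _, rfl⟩)
  · exact h 0 _
  · exact h n A

lemma adjoin_generators_le_span : (Algebra.adjoin ℂ (generators P)).toSubmodule ≤
    Submodule.span ℂ (Set.range fun p : ℕ × (Ω × Ω) => unitShift P p.1 p.2) := by
  have h1 : ∀ n A, shift P n A ∈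
      Submodule.span ℂ (Set.range fun p : ℕ × (Ω × Ω) => unitShift P p.1 p.2) := fun n A => by
    rw [shift_eq_sum]
    exact sum_mem fun x _ => Submodule.smul_mem _ _ (Submodule.subset_span ⟨(n, x), rfl⟩)
  -- The span is already an algebra, since a product of shifts is the shift by `U_{n,m}(A ⊗ B)`.
  have hmul : ∀ S ∈ Submodule.span ℂ (Set.range fun p : ℕ × (Ω × Ω) => unitShift P p.1 p.2),
      ∀ T ∈ Submodule.span ℂ (Set.range fun p : ℕ × (Ω × Ω) => unitShift P p.1 p.2),
      S * T ∈ Submodule.span ℂ (Set.range fun p : ℕ × (Ω × Ω) => unitShift P p.1 p.2) := by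
    intro S hS T hT
    have := Submodule.mul_mem_mul hS hT
    rw [Submodule.span_mul_span] at this
    refine Submodule.span_le.2 ?_ this
    rintro _ ⟨_, ⟨p, rfl⟩, _, ⟨q, rfl⟩, rfl⟩
    change unitShift P p.1 p.2 * unitShift P q.1 q.2 ∈ _
    rw [unitShift, unitShift, shift_mul_shift]
    exact h1 _ _
  intro T hT
  rw [Subalgebra.mem_toSubmodule] at hT
  induction hT using Algebra.adjoin_induction with
  | mem x hx => exact generators_subset_span P hx
  | algebraMap r =>
    rw [Algebra.algebraMap_eq_smul_one, ← shift_zero_one]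
    exact Submodule.smul_mem _ _ (h1 _ _)
  | add x y _ _ hx hy => exact add_mem hx hy
  | mul x y _ _ hx hy => exact hmul x hx y hy

lemma unitShift_mem_tensorAlgebra (n : ℕ) (x : Ω × Ω) : unitShift P n x ∈ tensorAlgebra P := by
  by_cases h : 0 < (P.1 ^ n) x.1 x.2
  · refine Subalgebra.le_topologicalClosure _ (Algebra.subset_adjoin (Or.inr ⟨n, _, ?_, rfl⟩))
    intro i j hij
    refine Matrix.single_apply_of_ne _ _ _ _ _ ?_
    rintro ⟨rfl, rfl⟩
    exact hij h
  · rw [unitShift_eq_zero h]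
    exact zero_mem _

/-- The shift by a matrix unit, as an element of the tensor algebra. -/
noncomputable def tensorUnitShift (n : ℕ) (x : Ω × Ω) : tensorSub P :=
  ⟨⟨unitShift P n x, tensorAlgebra_le P (unitShift_mem_tensorAlgebra P n x)⟩,
    unitShift_mem_tensorAlgebra P n x⟩

/-- The inclusion of the tensor algebra into the adjointable operators. -/
noncomputable def tensorIncl : tensorSub P →ₗ[ℂ] Adjointable (Ω → ℂ) (Fock P) :=
    (toeplitz P).subtype.toAlgHom.toLinearMap ∘ₗ (tensorSub P).val.toLinearMap

lemma isInducing_tensorIncl : Topology.IsInducing (tensorIncl P) :=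
  Topology.IsInducing.subtypeVal.comp .subtypeVal

lemma tensorIncl_mem (a : tensorSub P) : tensorIncl P a ∈ tensorAlgebra P := a.2

lemma tensorAlgebra_subset_closure :
  (tensorAlgebra P : Set (Adjointable (Ω → ℂ) (Fock P))) ⊆ closure
      (Submodule.span ℂ (Set.range fun p : ℕ × (Ω × Ω) => unitShift P p.1 p.2)) :=
    closure_mono (adjoin_generators_le_span P)

lemma _root_.Topology.IsInducing.dense_of_forall_mem_closure {X Y : Type*} [TopologicalSpace X]
    [TopologicalSpace Y] {f : X → Y} (hf : Topology.IsInducing f) {S : Set X}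
    (h : ∀ a, f a ∈ closure (f '' S)) : Dense S := fun a => by
  rw [hf.closure_eq_preimage_closure_image]
  exact h a

lemma dense_span_of_isInducing {E F : Type*} [AddCommGroup E] [Module ℂ E] [TopologicalSpace E]
    [AddCommGroup F] [Module ℂ F] [TopologicalSpace F] {f : E →ₗ[ℂ] F} (hf : Topology.IsInducing f)
    {ι : Type*} {x : ι → E} {y : ι → F} (hxy : ∀ i, f (x i) = y i)
    (h : ∀ a, f a ∈ closure (Submodule.span ℂ (Set.range y) : Set F)) :
    Dense (Submodule.span ℂ (Set.range x) : Set E) := by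
  refine hf.dense_of_forall_mem_closure fun a => ?_
  rw [← Submodule.map_coe, Submodule.map_span, ← Set.range_comp,
    show f ∘ x = y from funext hxy]
  exact h a

lemma dense_span_tensorUnitShift : Dense (Submodule.span ℂ
    (Set.range fun p : ℕ × (Ω × Ω) => tensorUnitShift P p.1 p.2) : Set (tensorSub P)) :=
  dense_span_of_isInducing (isInducing_tensorIncl P) (fun _ => rfl)
    fun a => tensorAlgebra_subset_closure P (tensorIncl_mem P a)

lemma dense_adjoin_tensorUnitShift : Dense (StarAlgebra.adjoin ℂ
    (Set.range fun p : ℕ × (Ω × Ω) => (tensorUnitShift P p.1 p.2 : toeplitz P)) :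
      Set (toeplitz P)) := by
  have hf : Topology.IsInducing (toeplitz P).subtype := .subtypeVal
  have e : ((toeplitz P).subtype ∘ fun p : ℕ × (Ω × Ω) =>
      (tensorUnitShift P p.1 p.2 : toeplitz P)) = fun p => unitShift P p.1 p.2 := rfl
  have h : StarAlgebra.adjoin ℂ (generators P) ≤
      StarAlgebra.adjoin ℂ (Set.range fun p : ℕ × (Ω × Ω) => unitShift P p.1 p.2) :=
    StarAlgebra.adjoin_le fun T hT => 
      (Submodule.span_le (p := (StarAlgebra.adjoin ℂ (Set.range fun p : ℕ × (Ω × Ω) =>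
        unitShift P p.1 p.2)).toSubalgebra.toSubmodule)).2 (StarAlgebra.subset_adjoin ℂ _)
        (generators_subset_span P hT)
  intro a
  have ha : (toeplitz P).subtype a ∈ (toeplitz P : Set (Adjointable (Ω → ℂ) (Fock P))) := a.2
  rw [hf.closure_eq_preimage_closure_image, Set.mem_preimage, ← StarSubalgebra.coe_map,
    StarAlgHom.map_adjoin, ← Set.range_comp, e]
  exact closure_mono h ha

end Membership

end StochMatrix

/-! ### Diagonal operators on the Fock correspondence -/

namespace StochMatrix

open scoped ComplexOrder

set_option linter.unusedSectionVars false

variable {Ω : Type*} [Fintype Ω] [DecidableEq Ω] {P : Matrix.rowStochastic ℝ Ω}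

/-- The operator `T` multiplies the entry `(i, j)` of the `n`-th component by `d n i j`. -/
def ActsDiag (T : Adjointable (Ω → ℂ) (Fock P)) (d : ℕ → Ω → Ω → ℝ) : Prop :=
  ∀ ξ n i j, 0 < (P.1 ^ n) i j → component (T ξ) n i j = d n i j * component ξ n i j

namespace ActsDiag

variable {T S : Adjointable (Ω → ℂ) (Fock P)} {d e : ℕ → Ω → Ω → ℝ}

lemma one : ActsDiag (1 : Adjointable (Ω → ℂ) (Fock P)) fun _ _ _ => 1 := fun ξ n i j _ => by simp

lemma zero : ActsDiag (0 : Adjointable (Ω → ℂ) (Fock P)) fun _ _ _ => 0 := fun ξ n i j h => by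
  simp [component]

lemma add (hT : ActsDiag T d) (hS : ActsDiag S e) : ActsDiag (T + S) (d + e) :=
  fun ξ n i j h => by
    rw [Adjointable.add_apply, component_add, Pi.add_apply, Matrix.add_apply, hT ξ n i j h,
      hS ξ n i j h]
    simp [add_mul]

lemma smul (hT : ActsDiag T d) (c : ℝ) : ActsDiag ((c : ℂ) • T) (c • d) := fun ξ n i j h => by
  rw [Adjointable.smul_apply, component_smul, Pi.smul_apply, Matrix.smul_apply, hT ξ n i j h]
  simp [mul_assoc]

lemma sub (hT : ActsDiag T d) (hS : ActsDiag S e) : ActsDiag (T - S) (d - e) := by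
  have := hT.add (hS.smul (-1))
  simpa [sub_eq_add_neg] using this

lemma sum {ι : Type*} (s : Finset ι) {T : ι → Adjointable (Ω → ℂ) (Fock P)}
    {d : ι → ℕ → Ω → Ω → ℝ} (h : ∀ x ∈ s, ActsDiag (T x) (d x)) :
    ActsDiag (∑ x ∈ s, T x) (∑ x ∈ s, d x) := by
  classical
  induction s using Finset.induction_on with
  | empty => simpa using! zero
  | insert x s hx ih =>
    rw [Finset.sum_insert hx, Finset.sum_insert hx]
    exact (h x (Finset.mem_insert_self x s)).add (ih fun y hy => h y (Finset.mem_insert_of_mem hy))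

lemma congr (hT : ActsDiag T d) (h : ∀ n i j, 0 < (P.1 ^ n) i j → d n i j = e n i j) :
    ActsDiag T e := fun ξ n i j hn => by rw [hT ξ n i j hn, h n i j hn]

lemma eq_of (hT : ActsDiag T d) (hS : ActsDiag S d) : T = S := ext_component fun ξ n => by
  ext i j
  by_cases h : 0 < (P.1 ^ n) i j
  · rw [hT ξ n i j h, hS ξ n i j h]
  · rw [component_mem _ n i j h, component_mem _ n i j h]

lemma isSelfAdjoint (hT : ActsDiag T d) : IsSelfAdjoint T :=
  Adjointable.eq_star_of fun ξ η => funext fun j => by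
    rw [inner_eq, inner_eq]
    refine tsum_congr fun n => ?_
    simp only [Matrix.mul_apply, Matrix.conjTranspose_apply]
    refine Finset.sum_congr rfl fun i _ => ?_
    by_cases h : 0 < (P.1 ^ n) i j
    · rw [hT ξ n i j h, hT η n i j h]
      simp [mul_left_comm, mul_assoc]
    · simp [component_mem _ n i j h]

lemma mul (hT : ActsDiag T d) (hS : ActsDiag S e) : ActsDiag (T * S) (d * e) :=
  fun ξ n i j h => by
    rw [Adjointable.mul_apply, hT _ n i j h, hS _ n i j h]
    simp [mul_assoc]

end ActsDiag

variable (P) in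
/-- Every bounded family of real numbers defines a diagonal operator. -/
lemma exists_actsDiag {d : ℕ → Ω → Ω → ℝ} {c : ℝ} (hd : ∀ n i j, |d n i j| ≤ c) :
    ∃ T : Adjointable (Ω → ℂ) (Fock P), ActsDiag T d := by
  let f : (ℕ → Matrix Ω Ω ℂ) →ₗ[ℂ] (ℕ → Matrix Ω Ω ℂ) :=
    { toFun := fun x n => Matrix.of fun i j => d n i j * x n i j
      map_add' := fun x y => by ext; simp [mul_add]
      map_smul' := fun a x => by ext; simp [mul_left_comm] }
  have hf : ∀ x n i j, f x n i j = d n i j * x n i j := fun _ _ _ _ => rfl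
  have hsq : ∀ x, SqSummable x → SqSummable (f x) := fun x hx i j => by
    refine Summable.of_nonneg_of_le (fun n => by positivity) (fun n => ?_) ((hx i j).mul_left (c ^ 2))
    rw [hf, norm_mul, mul_pow, Complex.norm_real, Real.norm_eq_abs]
    gcongr
    exact hd n i j
  have hmem : ∀ x : ℕ → Matrix Ω Ω ℂ, (∀ n, x n ∈ Arv P n) → ∀ n, f x n ∈ Arv P n :=
    fun x hx n i j h => by rw [hf, hx n i j h, mul_zero]
  refine ⟨opOfComponents f f hsq hsq hmem hmem fun x y j => tsum_congr fun n => ?_,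
    fun ξ n i j _ => ?_⟩
  · simp only [Matrix.mul_apply, Matrix.conjTranspose_apply, hf]
    refine Finset.sum_congr rfl fun i _ => ?_
    simp [mul_left_comm, mul_assoc]
  · rw [component_opOfComponents, hf]

/-- The diagonal operator `Y` with entries `√d` need not lie in the Toeplitz algebra. Thus `T = Y*
Y` shows positivity only among all adjointable operators; spectral permanence brings it down to
`toeplitz P`. -/
lemma ActsDiag.nonneg {T : toeplitz P} {d : ℕ → Ω → Ω → ℝ}
    (hT : ActsDiag (T : Adjointable (Ω → ℂ) (Fock P)) d)
    (h0 : ∀ n i j, 0 < (P.1 ^ n) i j → 0 ≤ d n i j) {c : ℝ} (hc : ∀ n i j, d n i j ≤ c) :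
    0 ≤ T := by
  obtain ⟨Y, hY⟩ := exists_actsDiag P (d := fun n i j => √(d n i j)) (c := √c) fun n i j => by
    rw [abs_of_nonneg (Real.sqrt_nonneg _)]
    exact Real.sqrt_le_sqrt (hc n i j)
  have e : (T : Adjointable (Ω → ℂ) (Fock P)) = star Y * Y := by
    rw [hY.isSelfAdjoint.star_eq]
    exact hT.eq_of ((hY.mul hY).congr fun n i j h => Real.mul_self_sqrt (h0 n i j h))
  have hsa : IsSelfAdjoint T := Subtype.ext hT.isSelfAdjoint
  let : PartialOrder (Adjointable (Ω → ℂ) (Fock P)) := CStarAlgebra.spectralOrder _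
  have : StarOrderedRing (Adjointable (Ω → ℂ) (Fock P)) := CStarAlgebra.spectralOrderedRing _
  have hnn : 0 ≤ (T : Adjointable (Ω → ℂ) (Fock P)) := e ▸ star_mul_self_nonneg Y
  rw [StarOrderedRing.nonneg_iff_spectrum_nonneg (R := ℝ) T hsa]
  rw [StarOrderedRing.nonneg_iff_spectrum_nonneg (R := ℝ) _ hT.isSelfAdjoint] at hnn
  intro x hx
  refine hnn x ?_
  have h1 : (algebraMap ℝ ℂ x) ∈ spectrum ℂ T := by
    rwa [spectrum.algebraMap_mem_iff]
  rw [← spectrum.algebraMap_mem_iff ℂ, ← StarSubalgebra.spectrum_eq (toeplitz P)]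
  exact h1

lemma ActsDiag.norm_mul_fiberProj_le {T : Adjointable (Ω → ℂ) (Fock P)} {d : ℕ → Ω → Ω → ℝ}
    (hT : ActsDiag T d) {n : ℕ} {ε : ℝ} (hε : 0 ≤ ε)
    (h : ∀ i j, 0 < (P.1 ^ n) i j → |d n i j| ≤ ε) : ‖T * fiberProj P n‖ ≤ ε := by
  rw [← Adjointable.norm_toCLM]
  refine ContinuousLinearMap.opNorm_le_bound _ hε fun ξ => ?_
  rw [Adjointable.coe_toCLM]
  set η : Fock P := (T * fiberProj P n) ξ with hη
  have hcoord : ∀ j (x : Col P j), ‖η j x‖ ≤ ε * ‖ξ j x‖ := fun j x => by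
    rw [← component_coe, ← component_coe, hη, Adjointable.mul_apply, hT _ _ _ _ x.2,
      component_fiberProj, norm_mul, Complex.norm_real, Real.norm_eq_abs]
    by_cases hx : x.1.1 = n
    · rw [if_pos hx]
      gcongr
      have := h x.1.2 j
      rw [← hx] at this
      exact this x.2
    · rw [if_neg hx]
      simp
      positivity
  refine (pi_norm_le_iff_of_nonneg (by positivity)).2 fun j => ?_
  refine le_trans ?_ (mul_le_mul_of_nonneg_left (norm_le_pi_norm ξ j) hε)
  have e : ε * ‖ξ j‖ = ‖(ε : ℂ) • ξ j‖ := by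
    rw [norm_smul, Complex.norm_real, Real.norm_of_nonneg hε]
  rw [e]
  refine lp.norm_mono (by simp) fun x => (hcoord j x).trans_eq ?_
  rw [lp.coeFn_smul, Pi.smul_apply, norm_smul, Complex.norm_real, Real.norm_of_nonneg hε]

lemma ActsDiag.mem_cuntzPimsnerIdeal {T : toeplitz P} {d : ℕ → Ω → Ω → ℝ}
    (hT : ActsDiag (T : Adjointable (Ω → ℂ) (Fock P)) d)
    (h : ∀ ε > 0, ∃ M, ∀ N ≥ M, ∀ i j, 0 < (P.1 ^ N) i j → |d N i j| ≤ ε) :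
    T ∈ cuntzPimsnerIdeal P := by
  refine Metric.tendsto_atTop.2 fun ε hε => ?_
  obtain ⟨M, hM⟩ := h (ε / 2) (half_pos hε)
  refine ⟨M, fun N hN => ?_⟩
  rw [Real.dist_eq, sub_zero, abs_of_nonneg (norm_nonneg _)]
  exact (hT.norm_mul_fiberProj_le (half_pos hε).le (hM N hN)).trans_lt (half_lt_self hε)

section Units

lemma component_unitShift_mul_star (n N : ℕ) (x : Ω × Ω) (ξ : Fock P) (a b : Ω) :
    component ((unitShift P n x * star (unitShift P n x)) ξ) N a b =
      ((if n ≤ N ∧ a = x.1 then weight P n (N - n) x.1 x.2 b ^ 2 else 0 : ℝ) : ℂ) *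
        component ξ N a b := by
  rw [Adjointable.mul_apply, unitShift]
  rcases lt_or_ge N n with h | h
  · rw [component_shift_of_lt P h, if_neg (by omega)]
    simp
  · obtain ⟨m, rfl⟩ := Nat.exists_eq_add_of_le h
    rw [component_shift, component_star_shift, subprod_single, subprodAdj_single,
      Nat.add_sub_cancel_left]
    by_cases ha : a = x.1
    · rw [if_pos ha, if_pos rfl, if_pos ⟨h, ha⟩, ← ha]
      push_cast
      ring
    · simp [ha]

lemma actsDiag_star_mul_unitShift (n : ℕ) (x : Ω × Ω) :
    ActsDiag (star (unitShift P n x) * unitShift P n x)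
      fun N a b => if a = x.2 then weight P n N x.1 x.2 b ^ 2 else 0 := fun ξ N a b _ => by
  rw [Adjointable.mul_apply, unitShift, component_star_shift, component_shift, subprodAdj_single,
    subprod_single]
  by_cases ha : a = x.2
  · simp only [ha, if_true]
    push_cast
    ring
  · simp [ha]

/-- The row sum is the projection onto the levels `≥ n`: the squared weights over the intermediate
state are probabilities and add up to `1`. -/
lemma actsDiag_row (n : ℕ) :
    ActsDiag (∑ x, unitShift P n x * star (unitShift P n x))
      fun N _ _ => if n ≤ N then 1 else 0 := by
  refine (ActsDiag.sum Finset.univ fun x _ => fun ξ N a b _ =>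
    component_unitShift_mul_star n N x ξ a b).congr fun N a b h => ?_
  rw [Finset.sum_apply, Finset.sum_apply, Finset.sum_apply, Fintype.sum_prod_type]
  by_cases hN : n ≤ N
  · obtain ⟨m, rfl⟩ := Nat.exists_eq_add_of_le hN
    rw [if_pos hN, Finset.sum_eq_single a (fun i _ hi => by simp [Ne.symm hi]) (by simp),
      ← sum_weight_sq h]
    simp
  · simp [hN]

lemma actsDiag_unitShift_zero (j : Ω) :
    ActsDiag (unitShift P 0 (j, j)) fun _ a _ => if a = j then 1 else 0 := fun ξ N a b h => by
  have := component_shift (P := P) 0 N (Matrix.single j j 1) ξ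
  rw [zero_add] at this
  rw [unitShift, this, subprod_single 0 N (j, j)]
  by_cases ha : a = j
  · subst ha
    simp [weight_zero_left P N a a b h]
  · simp [ha]

end Units

end StochMatrix

/-! ### The matrix unit shifts form a rigid family -/

namespace StochMatrix

open scoped ComplexOrder

set_option linter.unusedSectionVars false

variable {Ω : Type*} [Fintype Ω] [DecidableEq Ω] {P : Matrix.rowStochastic ℝ Ω}

lemma coe_row (n : ℕ) : ((∑ x, (tensorUnitShift P n x : toeplitz P) *
    star (tensorUnitShift P n x : toeplitz P) : toeplitz P) : Adjointable (Ω → ℂ) (Fock P)) =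
      ∑ x, unitShift P n x * star (unitShift P n x) := by
  rw [← StarSubalgebra.coe_subtype, map_sum]
  rfl

lemma actsDiag_coe_row (n : ℕ) : ActsDiag ((∑ x, (tensorUnitShift P n x : toeplitz P) *
    star (tensorUnitShift P n x : toeplitz P) : toeplitz P) : Adjointable (Ω → ℂ) (Fock P))
      fun N _ _ => if n ≤ N then 1 else 0 := by
  rw [coe_row]
  exact actsDiag_row n

lemma ActsDiag.le {S T : toeplitz P} {d e : ℕ → Ω → Ω → ℝ}
    (hS : ActsDiag (S : Adjointable (Ω → ℂ) (Fock P)) d)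
    (hT : ActsDiag (T : Adjointable (Ω → ℂ) (Fock P)) e)
    (h : ∀ n i j, 0 < (P.1 ^ n) i j → d n i j ≤ e n i j) {c : ℝ}
    (hc : ∀ n i j, e n i j - d n i j ≤ c) : S ≤ T := by
  rw [← sub_nonneg]
  have hTS : ActsDiag ((T - S : toeplitz P) : Adjointable (Ω → ℂ) (Fock P)) (e - d) := hT.sub hS
  exact hTS.nonneg (fun n i j hn => sub_nonneg.2 (h n i j hn)) hc

/-- Two diagonal operators whose entries are asymptotically equal differ by an element of the
Cuntz–Pimsner ideal. -/
lemma ActsDiag.map_eq {H : Type*} [NormedAddCommGroup H] [InnerProductSpace ℂ H] [CompleteSpace H]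
    {ρ : toeplitz P →⋆ₐ[ℂ] (H →L[ℂ] H)} (hρ : ∀ T ∈ cuntzPimsnerIdeal P, ρ T = 0)
    {S T : toeplitz P} {d e : ℕ → Ω → Ω → ℝ}
    (hS : ActsDiag (S : Adjointable (Ω → ℂ) (Fock P)) d)
    (hT : ActsDiag (T : Adjointable (Ω → ℂ) (Fock P)) e)
    (h : ∀ ε > 0, ∃ M, ∀ N ≥ M, ∀ i j, 0 < (P.1 ^ N) i j → |d N i j - e N i j| ≤ ε) :
    ρ S = ρ T := by
  have hST : ActsDiag ((S - T : toeplitz P) : Adjointable (Ω → ℂ) (Fock P)) (d - e) := hS.sub hT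
  exact sub_eq_zero.1 (by rw [← map_sub]; exact hρ _ (hST.mem_cuntzPimsnerIdeal h))

lemma actsDiag_coe_one :
    ActsDiag ((1 : toeplitz P) : Adjointable (Ω → ℂ) (Fock P)) fun _ _ _ => 1 := ActsDiag.one

variable (P) in
/-- A multiple of a vertex projection. -/
noncomputable def vertex (c : ℝ) (j : Ω) : tensorSub P := (c : ℂ) • tensorUnitShift P 0 (j, j)

lemma actsDiag_vertex (c : ℝ) (j : Ω) :
    ActsDiag ((vertex P c j : toeplitz P) : Adjointable (Ω → ℂ) (Fock P))
      fun _ a _ => if a = j then c else 0 := by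
  have h : ActsDiag ((vertex P c j : toeplitz P) : Adjointable (Ω → ℂ) (Fock P)) _ :=
    (actsDiag_unitShift_zero j).smul c
  exact h.congr fun n a b _ => by by_cases ha : a = j <;> simp [ha]

lemma actsDiag_coe_star_mul (n : ℕ) (x : Ω × Ω) : ActsDiag
    ((star (tensorUnitShift P n x : toeplitz P) * (tensorUnitShift P n x : toeplitz P) :
      toeplitz P) : Adjointable (Ω → ℂ) (Fock P))
      fun N a b => if a = x.2 then weight P n N x.1 x.2 b ^ 2 else 0 :=
  actsDiag_star_mul_unitShift n x

/-- If `(x.1, x.2)` is not an edge of `P ^ n`, both terms vanish; otherwise this is the convergence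
of the ratios. -/
lemma abs_pow_sub_weight_sq (hP : P.1.IsIrreducible) (n : ℕ) (x : Ω × Ω) {ε : ℝ} (hε : 0 < ε) :
    ∃ M, ∀ N ≥ M, ∀ b, 0 < (P.1 ^ N) x.2 b →
      |(P.1 ^ n) x.1 x.2 - weight P n N x.1 x.2 b ^ 2| ≤ ε := by
  by_cases hx : 0 < (P.1 ^ n) x.1 x.2
  · obtain ⟨M, hM⟩ := exists_abs_ratio_sub_le hP hx hε
    refine ⟨M, fun N hN b hb => ?_⟩
    rw [weight_sq, abs_sub_comm]
    exact hM N hN b hb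
  · have h0 : (P.1 ^ n) x.1 x.2 = 0 := le_antisymm (not_lt.1 hx) (pow_nonneg P n _ _)
    refine ⟨0, fun N _ b _ => ?_⟩
    rw [weight_sq, h0]
    simpa using hε.le

lemma map_sum_tensorUnitShift_mul_star {H : Type*} [NormedAddCommGroup H] [InnerProductSpace ℂ H]
    [CompleteSpace H] {ρ : toeplitz P →⋆ₐ[ℂ] (H →L[ℂ] H)} (hρ : ∀ T ∈ cuntzPimsnerIdeal P, ρ T = 0)
    (n : ℕ) : ρ (∑ x, (tensorUnitShift P n x : toeplitz P) *
      star (tensorUnitShift P n x : toeplitz P)) = 1 := by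
  have h : ∀ ε > (0 : ℝ), ∃ M, ∀ N ≥ M, ∀ i j, 0 < (P.1 ^ N) i j →
      |(if n ≤ N then (1 : ℝ) else 0) - 1| ≤ ε := fun ε hε => ⟨n, fun N hN i j _ => by
    rw [if_pos hN, sub_self, abs_zero]
    exact hε.le⟩
  exact ((actsDiag_coe_row (P := P) n).map_eq hρ actsDiag_coe_one h).trans (map_one ρ)

lemma exists_star_tensorUnitShift_mul_self_le (hP : P.1.IsIrreducible) {H : Type*}
    [NormedAddCommGroup H] [InnerProductSpace ℂ H] [CompleteSpace H]
    {ρ : toeplitz P →⋆ₐ[ℂ] (H →L[ℂ] H)} (hρ : ∀ T ∈ cuntzPimsnerIdeal P, ρ T = 0)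
    (n : ℕ) (x : Ω × Ω) {ε : ℝ} (hε : 0 < ε) {M : ℕ} (hM : ∀ N ≥ M, ∀ b, 0 < (P.1 ^ N) x.2 b →
      |(P.1 ^ n) x.1 x.2 - weight P n N x.1 x.2 b ^ 2| ≤ ε) :
    ∃ q : tensorSub P, IsSelfAdjoint (q : toeplitz P) ∧
      star (tensorUnitShift P n x : toeplitz P) * tensorUnitShift P n x +
        ∑ y, (tensorUnitShift P M y : toeplitz P) * star (tensorUnitShift P M y : toeplitz P) ≤
          ((1 + ε : ℝ) : ℂ) • 1 + (q : toeplitz P) ∧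
      ρ q = ρ (star (tensorUnitShift P n x : toeplitz P) * tensorUnitShift P n x) := by
  have hq := actsDiag_vertex (P := P) ((P.1 ^ n) x.1 x.2) x.2
  have hs := actsDiag_coe_star_mul (P := P) n x
  refine ⟨vertex P ((P.1 ^ n) x.1 x.2) x.2, Subtype.ext hq.isSelfAdjoint, ?_,
    hq.map_eq hρ hs fun ε hε => ?_⟩
  · have h1 : ActsDiag ((((1 + ε : ℝ) : ℂ) • 1 : toeplitz P) :
        Adjointable (Ω → ℂ) (Fock P)) _ := ActsDiag.one.smul (1 + ε)
    have hl : ActsDiag ((star (tensorUnitShift P n x : toeplitz P) * tensorUnitShift P n x +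
      ∑ x, (tensorUnitShift P M x : toeplitz P) * star (tensorUnitShift P M x : toeplitz P) :
        toeplitz P) : Adjointable (Ω → ℂ) (Fock P)) _ := hs.add (actsDiag_coe_row M)
    have hr : ActsDiag ((((1 + ε : ℝ) : ℂ) • 1 + (vertex P ((P.1 ^ n) x.1 x.2) x.2 : toeplitz P) :
      toeplitz P) : Adjointable (Ω → ℂ) (Fock P)) _ := h1.add hq
    have hp0 := pow_nonneg P n x.1 x.2
    refine hl.le hr (c := 1 + ε + (P.1 ^ n) x.1 x.2) (fun N a b hab => ?_) (fun N a b => ?_)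
    · have hw1 := pow_le_one₀ (n := 2) (weight_nonneg P n N x.1 x.2 b)
        (weight_le_one P n N x.1 x.2 b)
      simp only [Pi.add_apply, Pi.smul_apply, smul_eq_mul, mul_one]
      -- For `N ≥ M` the row contributes `1` and the squared weight is at most `P^n + ε` by `hM`.
      -- For `N < M` the row contributes `0`, and the bound `1` on the squared weight suffices.
      by_cases ha : a = x.2 <;> by_cases hN : M ≤ N <;> simp only [ha, hN, if_true, if_false]
      · have := abs_le.1 (hM N hN b (ha ▸ hab))
        linarith
      · linarith
      · linarith
      · linarith
    · have := sq_nonneg (weight P n N x.1 x.2 b)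
      simp only [Pi.add_apply, Pi.smul_apply, smul_eq_mul, mul_one]
      by_cases ha : a = x.2 <;> by_cases hN : M ≤ N <;> simp only [ha, hN, if_true, if_false] <;>
        linarith
  · obtain ⟨M, hM⟩ := abs_pow_sub_weight_sq hP n x hε
    refine ⟨M, fun N hN a b hab => ?_⟩
    by_cases ha : a = x.2
    · simpa [ha] using hM N hN b (ha ▸ hab)
    · simpa [ha] using hε.le

theorem isRigidFamily_tensorUnitShift (hP : P.1.IsIrreducible) {H : Type*} [NormedAddCommGroup H]
    [InnerProductSpace ℂ H] [CompleteSpace H] {ρ : toeplitz P →⋆ₐ[ℂ] (H →L[ℂ] H)}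
    (hρ : ∀ T ∈ cuntzPimsnerIdeal P, ρ T = 0) :
    OpAlg.IsRigidFamily (tensorSub P) ρ (tensorUnitShift P) where
  row_le n := (actsDiag_coe_row n).le actsDiag_coe_one (c := 1)
    (fun N i j _ => by by_cases h : n ≤ N <;> simp [h])
    (fun N i j => by by_cases h : n ≤ N <;> simp [h])
  map_row n := map_sum_tensorUnitShift_mul_star hρ n
  -- The compensating row is the one whose degree is the threshold `M` of the convergence.
  le_row n x _ hε := (abs_pow_sub_weight_sq hP n x hε).imp fun _ hM =>
    exists_star_tensorUnitShift_mul_self_le hP hρ n x hε hM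

end StochMatrix

theorem mainTheorem11 {Ω : Type u} [Fintype Ω] [DecidableEq Ω]
    (P : Matrix.rowStochastic ℝ Ω) (hP : P.1.IsIrreducible)
    {H : Type v} [NormedAddCommGroup H] [InnerProductSpace ℂ H] [CompleteSpace H]
    (ρ : StochMatrix.toeplitz P →⋆ₐ[ℂ] (H →L[ℂ] H))
    (hρ : ∀ T ∈ StochMatrix.cuntzPimsnerIdeal P, ρ T = 0) :
    OpAlg.IsMaximal.{u, v, w} (StochMatrix.tensorSub P)
        (OpAlg.restrictRep (StochMatrix.tensorSub P) ρ) ∧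
      OpAlg.HasUEP (StochMatrix.tensorSub P)
        (OpAlg.restrictRep (StochMatrix.tensorSub P) ρ) := by
  have hs := StochMatrix.isRigidFamily_tensorUnitShift hP hρ
  exact ⟨hs.isMaximal (StochMatrix.dense_span_tensorUnitShift P),
    hs.hasUEP (StochMatrix.dense_adjoin_tensorUnitShift P)⟩
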